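/- **Machines.** A *quadruple machine* over a finite input alphabet $A$ has a finite set $Q$ of states, with an initial state, an accepting state $q_y$ and a rejecting state $q_n\neq q_y$, a finite tape alphabet $\Gamma\supseteq A$ with a blank symbol not in $A$, and a finite set of instructions $q\,s\,\mathrm{Op}\,q'$, where $q,q'\in Q$, $s\in\Gamma$ and $\mathrm{Op}\in\Gamma\cup\{R,L\}$ (write a symbol, move right, move left). Several instructions may begin with the same pair $q\,s$. Each of the first two symbols of an instruction may carry an *inconsistency condition*, written $q^\bullet$, $s^\bullet$. A *configuration* consists of a state, a scanned cell and the contents of a tape whose cells are indexed by $\mathbb Z$. On input $x\in A^*$ the machine starts in the initial state, scanning cell $0$, with $x$ on the cells $0,\dots,|x|-1$ and blanks elsewhere. An *NDTM* is a quadruple machine without inconsistency conditions, with the usual nondeterministic semantics; NP is the class of languages $L$ for which there are an NDTM and a polynomial $p$ such that on every input $x$ all computation paths have length at most $p(|x|)$, and $x\in L$ iff some path halts in $q_y$. **EParTMs.** An *entangled paraconsistent Turing machine* (EParTM) is a quadruple machine run as follows. At each time $t$ it is in a *superposed configuration*, a set of distinct configurations; at time $0$ this is the set containing only the initial configuration.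 In a superposed configuration $S$, an instruction $q\,s\,\mathrm{Op}\,q'$ is to be executed on $c\in S$ if $c$ is in state $q$ scanning the symbol $s$ and the instruction's conditions hold: $q^\bullet$ requires that two members of $S$ differ in state or position, and $s^\bullet$ requires that two members of $S$ differ in the symbol on the cell scanned by $c$. In one step every $c\in S$ on which $n\ge 1$ instructions are to be executed splits into $n$ copies, each of which executes a different one of them; a member on which none is to be executed stays unchanged; coinciding results are identified. The machine stops when no instruction is to be executed on any member of $S$. It *decides* $L\subseteq A^*$ in polynomial time with error probability at most $\varepsilon$ if there is a polynomial $p$ such that on every $x\in A^*$ it stops within $p(|x|)$ steps in a superposed configuration all of whose members are in state $q_y$ or $q_n$, the proportion of members in state $q_y$ being at least $1-\varepsilon$ if $x\in L$, and the proportion of members in state $q_n$ being at least $1-\varepsilon$ if $x\notin L$. BEParTM-PTIME is the class of languages decided in polynomial time by some EParTM with error probability at most $\tfrac13$. **CSAT.** CSAT is the set of codes of satisfiable propositional formulas in conjunctive normal form. A formula is a finite list of clauses, a clause a finite list of literals, and a literal a variable $x_i$ ($i\in\mathbb N$) or its negation; the code is a word over a five-letter alphabet, in which each literal is written as a sign letter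 followed by the binary digits of $i$, least significant first, and each clause is followed by an end mark. **Theorem.** CSAT is in BEParTM-PTIME; indeed, CSAT is decided in polynomial time by some EParTM with error probability $0$. Consequently, every language in NP (over any finite alphabet) is decided in polynomial time by some EParTM with error probability $0$. -/

import Mathlib

/-- The action of a quadruple instruction: write a symbol, move right, or move left. -/
inductive TMAction (Γ : Type) where
  | write (s : Γ)
  | right
  | left

/-- A quadruple instruction `q s Op q'`.  The flag `stateInc` says that the first symbol of the
quadruple carries an inconsistency condition (`q•`), the flag `symbolInc` that the second one
does (`s•`). -/
structure TMInstr (Q Γ : Type) where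
  state : Q
  stateInc : Bool
  symbol : Γ
  symbolInc : Bool
  action : TMAction Γ
  next : Q

/-- A classical configuration: current state, scanned cell, contents of the two-way infinite
tape. -/
structure TMConfig (Q Γ : Type) where
  state : Q
  pos : ℤ
  tape : ℤ → Γ

namespace TMInstr

variable {Q Γ : Type}

/-- The quadruple's first two symbols are the current state and the scanned symbol. -/
def Matches (i : TMInstr Q Γ) (c : TMConfig Q Γ) : Prop :=
  c.state = i.state ∧ c.tape c.pos = i.symbol

/-- The configuration obtained from `c` by performing the instruction. -/
def apply (i : TMInstr Q Γ) (c : TMConfig Q Γ) : TMConfig Q Γ :=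
  match i.action with
  | .write s => ⟨i.next, c.pos, Function.update c.tape c.pos s⟩
  | .right => ⟨i.next, c.pos + 1, c.tape⟩
  | .left => ⟨i.next, c.pos - 1, c.tape⟩

/-- In the superposed configuration `S`, the instruction is to be executed on the member `c`:
it matches `c`; if it carries a condition `q•`, then two members of `S` differ in the current
state or in the position; if it carries a condition `s•`, then two members of `S` differ in
the symbol on the cell where the instruction would be executed. -/
def Executable (S : Set (TMConfig Q Γ)) (c : TMConfig Q Γ) (i : TMInstr Q Γ) : Prop :=
  i.Matches c ∧
  (i.stateInc = true → ∃ d ∈ S, ∃ e ∈ S, d.state ≠ e.state ∨ d.pos ≠ e.pos) ∧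
  (i.symbolInc = true → ∃ d ∈ S, ∃ e ∈ S, d.tape c.pos ≠ e.tape c.pos)

end TMInstr

/-- A Turing machine given by finitely many quadruples, several of which may begin with the same
two symbols, and which may carry inconsistency conditions.  `A` is the alphabet of the input
words, which is embedded in the set `Γ` of tape symbols. -/
structure EParTM (A : Type) where
  Q : Type
  Γ : Type
  finiteQ : Finite Q
  finiteΓ : Finite Γ
  blank : Γ
  embed : A → Γ
  embed_injective : Function.Injective embed
  embed_ne_blank : ∀ a, embed a ≠ blank
  start : Q
  accept : Q
  reject : Q
  accept_ne_reject : accept ≠ reject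
  instrs : Set (TMInstr Q Γ)

namespace EParTM

variable {A : Type}

/-- Configurations of the machine. -/
abbrev Cfg (M : EParTM A) : Type := TMConfig M.Q M.Γ

/-- The initial configuration: initial state, cell `0` scanned, the input on the cells
`0, …, |x| - 1`, and all other cells blank. -/
def init (M : EParTM A) (x : List A) : M.Cfg where
  state := M.start
  pos := 0
  tape := fun y => if 0 ≤ y then (x[y.toNat]?.map M.embed).getD M.blank else M.blank

/-! ### Entangled paraconsistent semantics -/

/-- One step of a superposed configuration.  A member on which instructions are to be executed
splits into one copy for each of them; a member on which none is to be executed is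
unchanged. -/
def step (M : EParTM A) (S : Set M.Cfg) : Set M.Cfg :=
  {c' | ∃ c ∈ S, (∃ i ∈ M.instrs, i.Executable S c ∧ c' = i.apply c) ∨
    ((∀ i ∈ M.instrs, ¬ i.Executable S c) ∧ c' = c)}

/-- The superposed configuration at time `t` on input `x`. -/
def superposed (M : EParTM A) (x : List A) : ℕ → Set M.Cfg
  | 0 => {M.init x}
  | t + 1 => M.step (M.superposed x t)

theorem superposed_nonempty (M : EParTM A) (x : List A) (t : ℕ) :
    (M.superposed x t).Nonempty := by
  induction t with
  | zero => exact Set.singleton_nonempty _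
  | succ t ih =>
    obtain ⟨c, hc⟩ := ih
    by_cases h : ∃ i ∈ M.instrs, i.Executable (M.superposed x t) c
    · obtain ⟨i, hi, he⟩ := h
      exact ⟨i.apply c, c, hc, Or.inl ⟨i, hi, he, rfl⟩⟩
    · push Not at h
      exact ⟨c, c, hc, Or.inr ⟨h, rfl⟩⟩

theorem finite_instrs (M : EParTM A) : M.instrs.Finite := by
  have := M.finiteQ
  have := M.finiteΓ
  let f : TMInstr M.Q M.Γ → M.Q × Bool × M.Γ × Bool × (Option (Option M.Γ)) × M.Q := fun i =>
    (i.state, i.stateInc, i.symbol, i.symbolInc,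
      (match i.action with
        | .write s => some (some s)
        | .right => some none
        | .left => none), i.next)
  have hf : Function.Injective f := by
    rintro ⟨a, b, c, d, e, g⟩ ⟨a', b', c', d', e', g'⟩ h
    cases e <;> cases e' <;> simp_all [f]
  have : Finite (TMInstr M.Q M.Γ) := Finite.of_injective f hf
  exact Set.toFinite _

theorem superposed_finite (M : EParTM A) (x : List A) (t : ℕ) :
    (M.superposed x t).Finite := by
  induction t with
  | zero => exact Set.finite_singleton _
  | succ t ih =>
    refine ((Set.Finite.image2 (fun i c => i.apply c) M.finite_instrs ih).union ih).subset ?_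
    rintro c' ⟨c, hc, ⟨i, hi, -, rfl⟩ | ⟨-, rfl⟩⟩
    · exact Or.inl ⟨i, hi, c, hc, rfl⟩
    · exact Or.inr hc

/-- The machine stops in `S`: no instruction is to be executed on any member. -/
def Stops (M : EParTM A) (S : Set M.Cfg) : Prop :=
  ∀ c ∈ S, ∀ i ∈ M.instrs, ¬ i.Executable S c

/-- The proportion of the distinct members of `S` that are in state `q`. -/
noncomputable def prob (M : EParTM A) (S : Set M.Cfg) (q : M.Q) : ℚ :=
  (({c ∈ S | c.state = q}.ncard : ℕ) : ℚ) / ((S.ncard : ℕ) : ℚ)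

/-- `M` decides `L` with error probability at most `ε`, in time `T` (as a function of the length
of the input): on every input the machine stops after at most `T` steps, all final states are
the accepting or the rejecting one, inputs in `L` are accepted with probability at least
`1 - ε`, and inputs outside `L` are rejected with probability at least `1 - ε`. -/
def DecidesInTime (M : EParTM A) (L : Language A) (ε : ℚ) (T : ℕ → ℕ) : Prop :=
  ∀ x : List A, ∃ t ≤ T x.length,
    M.Stops (M.superposed x t) ∧
    (∀ c ∈ M.superposed x t, c.state = M.accept ∨ c.state = M.reject) ∧
    (x ∈ L → 1 - ε ≤ M.prob (M.superposed x t) M.accept) ∧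
    (x ∉ L → 1 - ε ≤ M.prob (M.superposed x t) M.reject)

/-! ### Nondeterministic semantics -/

/-- The machine is an ordinary nondeterministic Turing machine: no instruction carries an
inconsistency condition. -/
def IsNDTM (M : EParTM A) : Prop :=
  ∀ i ∈ M.instrs, i.stateInc = false ∧ i.symbolInc = false

/-- The configurations that end a computation path of length `n` on input `x`, in the usual
nondeterministic semantics. -/
def reach (M : EParTM A) (x : List A) : ℕ → Set M.Cfg
  | 0 => {M.init x}
  | n + 1 => {c' | ∃ c ∈ M.reach x n, ∃ i ∈ M.instrs, i.Matches c ∧ c' = i.apply c}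

/-- `M`, as a nondeterministic machine, decides `L` in time `T`: every computation path on `x`
has length at most `T |x|`, and `x` is in `L` iff some path halts in the accepting state. -/
def NDDecidesInTime (M : EParTM A) (L : Language A) (T : ℕ → ℕ) : Prop :=
  ∀ x : List A,
    (∀ n, (M.reach x n).Nonempty → n ≤ T x.length) ∧
    (x ∈ L ↔ ∃ n, ∃ c ∈ M.reach x n, (∀ i ∈ M.instrs, ¬ i.Matches c) ∧ c.state = M.accept)

end EParTM

/-- `L` is decided in polynomial time by some EParTM with error probability at most `ε`. -/
def EParTMPolyTime {A : Type} (L : Language A) (ε : ℚ) : Prop :=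
  ∃ (M : EParTM A) (p : Polynomial ℕ), M.DecidesInTime L ε (fun n => p.eval n)

/-- The class BEParTM-PTIME (of languages over the alphabet `A`). -/
def BEParTMPTIME (A : Type) : Set (Language A) :=
  {L | EParTMPolyTime L (1 / 3)}

/-- The class NP (of languages over the alphabet `A`). -/
def ClassNP (A : Type) : Set (Language A) :=
  {L | ∃ (M : EParTM A) (p : Polynomial ℕ),
    M.IsNDTM ∧ M.NDDecidesInTime L (fun n => p.eval n)}

/-! ### Conjunctive normal forms -/

/-- A literal: the variable `x_i`, negated or not. -/
inductive CNFLiteral where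
  | pos (i : ℕ)
  | neg (i : ℕ)

/-- The literal is true under the valuation `v`. -/
def CNFLiteral.Holds (v : ℕ → Bool) : CNFLiteral → Prop
  | .pos i => v i = true
  | .neg i => v i = false

/-- A clause is a finite disjunction of literals. -/
abbrev CNFClause : Type := List CNFLiteral

/-- A formula in conjunctive normal form is a finite conjunction of clauses. -/
abbrev CNFFormula : Type := List CNFClause

/-- Some valuation makes a literal of every clause true. -/
def CNFFormula.IsSat (φ : CNFFormula) : Prop :=
  ∃ v : ℕ → Bool, ∀ C ∈ φ, ∃ l ∈ C, l.Holds v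

/-- The alphabet in which formulas are written: `pos` and `neg` introduce an unnegated or a
negated variable, the two bits write its index, and `close` ends a clause. -/
inductive CNFSymbol where
  | pos
  | neg
  | bit (b : Bool)
  | close

/-- A literal is written as its sign followed by the index in binary, least significant bit
first. -/
def CNFLiteral.encode : CNFLiteral → List CNFSymbol
  | .pos i => .pos :: i.bits.map .bit
  | .neg i => .neg :: i.bits.map .bit

/-- A clause is written as its literals, one after another, and an end mark. -/
def CNFClause.encode (C : CNFClause) : List CNFSymbol :=
  C.flatMap CNFLiteral.encode ++ [.close]

/-- A formula is written as its clauses, one after another. -/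
def CNFFormula.encode (φ : CNFFormula) : List CNFSymbol :=
  φ.flatMap CNFClause.encode

/-- The set of (codes of) satisfiable formulas in conjunctive normal form. -/
def CSAT : Language CNFSymbol :=
  {w | ∃ φ : CNFFormula, φ.IsSat ∧ φ.encode = w}

/-!
CSAT is in NP, and every language in NP is decided by an EParTM without error.

**Nondeterminism by entanglement.** Let `M` be an NDTM.  The EParTM `M.sim` follows all computation
paths of `M` at once, as members of a superposed configuration, on a tape from which the cell `-1`
has been set aside: it is a flag cell, and the simulated head jumps over it.  A member whose path
has ended walks to the flag cell.  If its path accepts, it raises the flag and accepts.  Otherwise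
it leaves the flag down and rejects, but keeps one instruction: to accept if the flag cell is
inconsistent.  Every member has the flag down as long as its path has not ended, so the cell is
inconsistent exactly if some, but not all, members have raised their flags, and one accepting path
makes all members accept in the end.  The members need not be synchronised: a raised flag stays
raised, and a rejecting member can wait for it.  What the members look like at each time is
`EParTM.phase_of_mem_superposed`, and the conclusion is `EParTM.sim_decidesInTime`.

**CSAT is in NP.** Nondeterministic machines that rewrite a word letter by letter, in repeated
sweeps from left to right, are carried out by NDTMs with a polynomial overhead if the number of
sweeps is polynomially bounded (`Sweeper.ndDecidesInTime_machine`).  For CSAT, the first sweep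
checks the format and guesses one literal in each clause, erasing the others.  A formula is
satisfiable if and only if such a choice is possible without contradictory literals
(`isSat_iff_exists_choice`).  Whether the choice is contradictory is checked by comparing the first
index left with all others simultaneously, one letter in each sweep.  Such a sweep erases the
letter, so that the number of sweeps is at most linear (`csat_passes_le`).  That it is correct comes
down to an invariant, `NoContradiction`, about the remainder of the first index and those of the
indices that have agreed with it so far (`accepts_targetWord_iff`).
-/

/-! ### Entangled simulation of a nondeterministic machine -/

/-- Tape symbols of the simulating machine: those of the simulated one, and the two values of the
flag cell. -/
inductive SimSymbol (Γ : Type) where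
  | sym (s : Γ)
  | flag (b : Bool)

/-- States of the simulating machine: three to lay the flag cell, the simulated states, the way back
to the flag cell after a path has ended (`acc` says whether it accepts), and the two outcomes.  The
Boolean `left` says on which side of the flag cell the head is; a head on the flag cell itself has
come from that side. -/
inductive SimState (Q : Type) where
  | leave
  | lay
  | enter
  | run (q : Q) (left : Bool)
  | back (acc left : Bool)
  | yes
  | no

instance {Γ : Type} [Finite Γ] : Finite (SimSymbol Γ) :=
  Finite.of_surjective (fun s : Γ ⊕ Bool => s.elim SimSymbol.sym SimSymbol.flag) <| by
    rintro (s | b)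
    exacts [⟨.inl s, rfl⟩, ⟨.inr b, rfl⟩]

instance {Q : Type} [Finite Q] : Finite (SimState Q) :=
  Finite.of_surjective (fun s : (Q × Bool) ⊕ (Bool × Bool) ⊕ Fin 5 =>
    match s with
    | .inl (q, b) => SimState.run q b
    | .inr (.inl (a, b)) => .back a b
    | .inr (.inr 0) => .leave
    | .inr (.inr 1) => .lay
    | .inr (.inr 2) => .enter
    | .inr (.inr 3) => .yes
    | .inr (.inr 4) => .no) <| by
    rintro (_ | _ | _ | ⟨q, b⟩ | ⟨a, b⟩ | _ | _)
    exacts [⟨.inr (.inr 0), rfl⟩, ⟨.inr (.inr 1), rfl⟩, ⟨.inr (.inr 2), rfl⟩, ⟨.inl (q, b), rfl⟩,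
      ⟨.inr (.inl (a, b)), rfl⟩, ⟨.inr (.inr 3), rfl⟩, ⟨.inr (.inr 4), rfl⟩]

/-- The action of a simulated instruction, on the tape of the simulating machine. -/
def TMAction.lift {Γ : Type} : TMAction Γ → TMAction (SimSymbol Γ)
  | .write s => .write (.sym s)
  | .right => .right
  | .left => .left

/-- The move towards the flag cell from the given side. -/
def TMAction.toward {Γ : Type} (left : Bool) : TMAction Γ := if left then .right else .left

namespace EParTM

variable {A : Type}

open Classical in
/-- The instructions of the simulating machine. -/
inductive SimInstr (M : EParTM A) : TMInstr (SimState M.Q) (SimSymbol M.Γ) → Prop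
  | leave (s) : SimInstr M ⟨.leave, false, .sym s, false, .left, .lay⟩
  | lay (s) : SimInstr M ⟨.lay, false, .sym s, false, .write (.flag false), .enter⟩
  | enter : SimInstr M ⟨.enter, false, .flag false, false, .right, .run M.start false⟩
  | exec (i) (hi : i ∈ M.instrs) (left) :
      SimInstr M ⟨.run i.state left, false, .sym i.symbol, false, i.action.lift, .run i.next left⟩
  | cross (q left) :
      SimInstr M ⟨.run q left, false, .flag false, false, .toward left, .run q (!left)⟩
  | halt (q s) (h : ∀ i ∈ M.instrs, i.state = q → i.symbol ≠ s) (left) :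
      SimInstr M ⟨.run q left, false, .sym s, false, .write (.sym s),
        .back (decide (q = M.accept)) left⟩
  | home (acc left s) :
      SimInstr M ⟨.back acc left, false, .sym s, false, .toward left, .back acc left⟩
  | record (left) :
      SimInstr M ⟨.back true left, false, .flag false, false, .write (.flag true), .yes⟩
  | concede (left) :
      SimInstr M ⟨.back false left, false, .flag false, false, .write (.flag false), .no⟩
  | convert : SimInstr M ⟨.no, false, .flag false, true, .write (.flag false), .yes⟩

/-- The EParTM that simulates all computation paths of `M` at once and lets the acceptance of one
of them spread to all. -/
abbrev sim (M : EParTM A) : EParTM A where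
  Q := SimState M.Q
  Γ := SimSymbol M.Γ
  finiteQ := by have := M.finiteQ; infer_instance
  finiteΓ := by have := M.finiteΓ; infer_instance
  blank := .sym M.blank
  embed a := .sym (M.embed a)
  embed_injective a b h := M.embed_injective (by simpa using h)
  embed_ne_blank a h := M.embed_ne_blank a (by simpa using h)
  start := .leave
  accept := .yes
  reject := .no
  accept_ne_reject := by simp
  instrs := {i | SimInstr M i}

/-- A simulated tape, spread out so as to leave cell `-1` free for the flag: cells `0, 1, …` stay
in place, and cells `-1, -2, …` move one to the left. -/
def spread {Γ : Type} (T : ℤ → Γ) (b : Bool) (y : ℤ) : SimSymbol Γ :=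
  if y = -1 then .flag b else .sym (T (if y < 0 then y + 1 else y))

/-- The place of a simulated cell on the tape of the simulating machine. -/
def place (p : ℤ) : ℤ := if p < 0 then p - 1 else p

@[simp]
theorem spread_flag {Γ : Type} (T : ℤ → Γ) (b : Bool) : spread T b (-1) = .flag b := by
  simp [spread]

@[simp]
theorem spread_place {Γ : Type} (T : ℤ → Γ) (b : Bool) (p : ℤ) :
    spread T b (place p) = .sym (T p) := by
  unfold spread place
  split_ifs <;> first | omega | simp

theorem spread_of_ne {Γ : Type} (T : ℤ → Γ) (b : Bool) {y : ℤ} (hy : y ≠ -1) :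
    ∃ s, spread T b y = .sym s := by
  simp [spread, hy]

theorem update_spread_place {Γ : Type} (T : ℤ → Γ) (b : Bool) (p : ℤ) (s : Γ) :
    Function.update (spread T b) (place p) (.sym s) = spread (Function.update T p s) b := by
  funext y
  simp only [spread, place, Function.update_apply]
  split_ifs <;> first | omega | rfl

theorem update_spread_flag {Γ : Type} (T : ℤ → Γ) (b b' : Bool) :
    Function.update (spread T b) (-1) (.flag b') = spread T b' := by
  funext y
  by_cases hy : y = -1
  · subst hy; simp
  · simp [spread, Function.update, hy]

/-- The side of the flag cell on which a simulated cell is placed: `true` means left. -/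
def leftOf (p : ℤ) : Bool := decide (p < 0)

theorem exists_place_eq {p : ℤ} {k : ℕ} (hp : |p| ≤ k) :
    ∃ d ≤ k + 1, place p = if leftOf p then -1 - (d : ℤ) else -1 + d := by
  rw [abs_le] at hp
  refine ⟨(place p + 1).natAbs, ?_⟩
  unfold place leftOf
  by_cases h : p < 0 <;> simp only [h, decide_true, decide_false, if_true, if_false,
    Bool.false_eq_true] <;> omega

/-- The configuration of the simulating machine that stands for a configuration of `M`. -/
def simCfg (M : EParTM A) (m : M.Cfg) : M.sim.Cfg :=
  ⟨.run m.state (leftOf m.pos), place m.pos, spread m.tape false⟩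

/-- A computation path of `M` on `x` ends in `m`. -/
def HaltsIn (M : EParTM A) (x : List A) (k : ℕ) (m : M.Cfg) : Prop :=
  m ∈ M.reach x k ∧ ∀ i ∈ M.instrs, ¬ i.Matches m

/-- Some computation path of `M` on `x` ends in the accepting state. -/
def NDAccepts (M : EParTM A) (x : List A) : Prop :=
  ∃ k m, M.HaltsIn x k m ∧ m.state = M.accept

open Classical in
/-- What a member of the superposed configuration looks like, `τ` steps after the flag has been
laid and the simulation has begun.  The bounds on `τ` say that simulating one step takes at most
two steps, and that a copy whose path has ended goes straight to the flag cell. -/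
inductive Phase (M : EParTM A) (x : List A) (τ : ℕ) : M.sim.Cfg → Prop
  | run (k m) (hm : m ∈ M.reach x k) (hτ : τ ≤ 2 * k) : Phase M x τ (M.simCfg m)
  | cross (k m) (hm : m ∈ M.reach x k) (hτ : τ + 1 ≤ 2 * k) (hp : m.pos = 0 ∨ m.pos = -1) :
      Phase M x τ ⟨.run m.state (!leftOf m.pos), -1, spread m.tape false⟩
  | back (k m) (hm : M.HaltsIn x k m) (left : Bool) (d : ℕ) (hτ : τ + d ≤ 3 * k + 3) :
      Phase M x τ ⟨.back (decide (m.state = M.accept)) left,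
        if left then -1 - (d : ℤ) else -1 + d, spread m.tape false⟩
  | yes (k m) (hm : M.HaltsIn x k m) (hacc : m.state = M.accept) :
      Phase M x τ ⟨.yes, -1, spread m.tape true⟩
  | no (T) : Phase M x τ ⟨.no, -1, spread T false⟩
  | converted (T) (h : M.NDAccepts x) : Phase M x τ ⟨.yes, -1, spread T false⟩

theorem abs_pos_le_of_mem_reach (M : EParTM A) (x : List A) (k : ℕ) (m : M.Cfg)
    (hm : m ∈ M.reach x k) : |m.pos| ≤ k := by
  induction k generalizing m with
  | zero =>
    obtain rfl : m = M.init x := hm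
    simp [init]
  | succ k ih =>
    obtain ⟨c, hc, i, -, -, rfl⟩ := hm
    have := ih c hc
    rw [abs_le] at this ⊢
    unfold TMInstr.apply
    split <;> push_cast <;> constructor <;> linarith

/-- Whatever member of a superposed configuration carries the flag, it comes from an accepting
path. -/
theorem Phase.accepts_of_flag {M : EParTM A} {x : List A} {τ : ℕ} {c : M.sim.Cfg}
    (h : M.Phase x τ c) : c.tape (-1) = .flag false ∨ c.tape (-1) = .flag true ∧ M.NDAccepts x := by
  cases h with
  | yes k m hm hacc => exact Or.inr ⟨by simp, k, m, hm, hacc⟩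
  | _ => exact Or.inl (by simp [simCfg])

/-- One step of a simulated path takes one or two steps: two if the head crosses the flag cell. -/
theorem apply_exec (M : EParTM A) (m : M.Cfg) (i : TMInstr M.Q M.Γ) :
    let c : M.sim.Cfg := TMInstr.apply ⟨.run i.state (leftOf m.pos), false, .sym i.symbol,
      false, i.action.lift, .run i.next (leftOf m.pos)⟩ (M.simCfg m)
    c = M.simCfg (i.apply m) ∨ (((i.apply m).pos = 0 ∨ (i.apply m).pos = -1) ∧
      c = ⟨.run (i.apply m).state (!leftOf (i.apply m).pos), -1,
        spread (i.apply m).tape false⟩) := by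
  obtain ⟨q, b, s, b', a, q'⟩ := i
  cases a with
  | write s =>
    left
    simp [TMInstr.apply, TMAction.lift, simCfg, update_spread_place]
  | right =>
    by_cases h : m.pos = -1
    · right
      simp [TMInstr.apply, TMAction.lift, simCfg, h, place, leftOf]
    · left
      have hl : leftOf (m.pos + 1) = leftOf m.pos := decide_eq_decide.mpr (by omega)
      have hpl : place (m.pos + 1) = place m.pos + 1 := by
        unfold place
        split_ifs <;> omega
      simp only [TMInstr.apply, TMAction.lift, simCfg, hl, hpl]
  | left =>
    by_cases h : m.pos = 0
    · right
      simp [TMInstr.apply, TMAction.lift, simCfg, h, place, leftOf]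
    · left
      have hl : leftOf (m.pos - 1) = leftOf m.pos := decide_eq_decide.mpr (by omega)
      have hpl : place (m.pos - 1) = place m.pos - 1 := by
        unfold place
        split_ifs <;> omega
      simp only [TMInstr.apply, TMAction.lift, simCfg, hl, hpl]

/-- Crossing the flag cell brings the head to the cell where the simulated head is. -/
theorem apply_cross (M : EParTM A) (m : M.Cfg) (hp : m.pos = 0 ∨ m.pos = -1) :
    TMInstr.apply ⟨.run m.state (!leftOf m.pos), false, .flag false, false,
      .toward (!leftOf m.pos), .run m.state (!!leftOf m.pos)⟩
      (⟨.run m.state (!leftOf m.pos), -1, spread m.tape false⟩ : M.sim.Cfg) = M.simCfg m := by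
  rcases hp with h | h <;> simp [h, TMInstr.apply, TMAction.toward, simCfg, place, leftOf]

/-- An instruction executed on a member in some phase leads to a later phase. -/
theorem Phase.apply {M : EParTM A} {x : List A} {τ : ℕ} {S : Set M.sim.Cfg}
    (hS : ∀ c ∈ S, M.Phase x τ c) {c : M.sim.Cfg} (hc : c ∈ S) {i : TMInstr M.sim.Q M.sim.Γ}
    (hi : M.SimInstr i) (he : i.Executable S c) : M.Phase x (τ + 1) (i.apply c) := by
  obtain ⟨⟨h1, h2⟩, -, h4⟩ := he
  have hph := hS c hc
  cases hph with
  | run k m hm hτ =>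
    cases hi with
    | exec j hj left =>
      simp only [simCfg, SimState.run.injEq, spread_place, SimSymbol.sym.injEq] at h1 h2
      obtain ⟨hq, rfl⟩ := h1
      have hr : j.apply m ∈ M.reach x (k + 1) := ⟨m, hm, j, hj, ⟨hq, h2⟩, rfl⟩
      rcases M.apply_exec m j with h | ⟨hp, h⟩
      · rw [h]
        exact .run (k + 1) _ hr (by omega)
      · rw [h]
        exact .cross (k + 1) _ hr (by omega) hp
    | halt q s h left =>
      simp only [simCfg, SimState.run.injEq, spread_place, SimSymbol.sym.injEq] at h1 h2
      obtain ⟨rfl, rfl⟩ := h1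
      have hk := M.abs_pos_le_of_mem_reach x k m hm
      have hh : M.HaltsIn x k m := ⟨hm, fun i hi hmat => h i hi hmat.1.symm (hmat.2.symm.trans h2)⟩
      subst h2
      obtain ⟨d, hd, hpl⟩ := exists_place_eq hk
      convert Phase.back (τ := τ + 1) k m hh (leftOf m.pos) d (by omega) using 1
      simp only [TMInstr.apply, simCfg, update_spread_place, Function.update_eq_self]
      rw [hpl]
    | _ => simp [simCfg] at h1 h2
  | cross k m hm hτ hp =>
    cases hi with
    | cross q left =>
      simp only [SimState.run.injEq] at h1
      obtain ⟨rfl, rfl⟩ := h1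
      rw [apply_cross M m hp]
      exact .run k m hm (by omega)
    | _ => simp at h1 h2
  | back k m hm left d hτ =>
    cases hi with
    | home acc l s =>
      simp only [SimState.back.injEq] at h1
      obtain ⟨rfl, rfl⟩ := h1
      cases d with
      | zero => simp at h2
      | succ d =>
        convert Phase.back (τ := τ + 1) k m hm left d (by omega) using 1
        cases left <;> simp [TMInstr.apply, TMAction.toward] <;> ring
    | record l =>
      simp only [SimState.back.injEq, decide_eq_true_eq] at h1
      have hd : d = 0 := by
        by_contra hd
        obtain ⟨s, hs⟩ := spread_of_ne m.tape false
          (y := if left then -1 - (d : ℤ) else -1 + d) (by split_ifs <;> omega)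
        simp only at h2
        rw [hs] at h2
        cases h2
      subst hd
      convert Phase.yes (τ := τ + 1) k m hm h1.1 using 1
      simp [TMInstr.apply, update_spread_flag]
    | concede l =>
      have hd : d = 0 := by
        by_contra hd
        obtain ⟨s, hs⟩ := spread_of_ne m.tape false
          (y := if left then -1 - (d : ℤ) else -1 + d) (by split_ifs <;> omega)
        simp only at h2
        rw [hs] at h2
        cases h2
      subst hd
      convert Phase.no (τ := τ + 1) m.tape using 1
      simp [TMInstr.apply, update_spread_flag]
    | _ => simp at h1
  | no T =>
    cases hi with
    | convert =>
      obtain ⟨d, hd, e, he, hne⟩ := h4 rfl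
      simp only at hne
      have hacc : M.NDAccepts x := by
        rcases (hS d hd).accepts_of_flag with h | h
        · rcases (hS e he).accepts_of_flag with h' | h'
          · exact absurd (h.trans h'.symm) hne
          · exact h'.2
        · exact h.2
      convert Phase.converted (τ := τ + 1) T hacc using 1
      simp [TMInstr.apply, update_spread_flag]
    | _ => simp at h1
  | yes k m hm hacc => cases hi <;> simp at h1
  | converted T h => cases hi <;> simp at h1

theorem executable_of_matches {M : EParTM A} {S : Set M.Cfg} {c : M.Cfg}
    {i : TMInstr M.Q M.Γ} (h : i.Matches c) (h1 : i.stateInc = false) (h2 : i.symbolInc = false) :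
    i.Executable S c :=
  ⟨h, by simp [h1], by simp [h2]⟩

/-- As long as a member is neither in the accepting nor in the rejecting state, it moves on. -/
theorem Phase.exists_executable {M : EParTM A} {x : List A} {τ : ℕ} {c : M.sim.Cfg}
    (h : M.Phase x τ c) (S : Set M.sim.Cfg) :
    (∃ i, M.SimInstr i ∧ i.Executable S c) ∨ c.state = SimState.yes ∨ c.state = SimState.no := by
  cases h with
  | run k m hm hτ =>
    left
    by_cases hh : ∃ i ∈ M.instrs, i.Matches m
    · obtain ⟨i, hi, hq, hs⟩ := hh
      exact ⟨_, .exec i hi (leftOf m.pos), executable_of_matches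
        ⟨by simp [simCfg, hq], by simp [simCfg, hs]⟩ rfl rfl⟩
    · push Not at hh
      exact ⟨_, .halt m.state (m.tape m.pos) (fun i hi h1 h2 => hh i hi ⟨h1.symm, h2.symm⟩)
        (leftOf m.pos), executable_of_matches ⟨by simp [simCfg], by simp [simCfg]⟩ rfl rfl⟩
  | cross k m hm hτ hp =>
    exact .inl ⟨_, .cross _ _, executable_of_matches ⟨rfl, by simp⟩ rfl rfl⟩
  | back k m hm left d hτ =>
    left
    by_cases hd : d = 0
    · subst hd
      by_cases hacc : m.state = M.accept
      · exact ⟨_, .record left, executable_of_matches ⟨by simp [hacc], by simp⟩ rfl rfl⟩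
      · exact ⟨_, .concede left, executable_of_matches ⟨by simp [hacc], by simp⟩ rfl rfl⟩
    · obtain ⟨s, hs⟩ := spread_of_ne m.tape false
        (y := if left then -1 - (d : ℤ) else -1 + d) (by split_ifs <;> omega)
      exact ⟨_, .home _ left s, executable_of_matches ⟨rfl, hs⟩ rfl rfl⟩
  | yes => simp
  | no => simp
  | converted => simp

theorem Phase.of_final {M : EParTM A} {x : List A} {τ τ' : ℕ} {c : M.sim.Cfg}
    (h : M.Phase x τ c) (hc : c.state = SimState.yes ∨ c.state = SimState.no) :
    M.Phase x τ' c := by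
  cases h with
  | yes k m hm hacc => exact .yes k m hm hacc
  | no T => exact .no T
  | converted T h => exact .converted T h
  | _ => simp [simCfg] at hc

/-- Once the flag cell is laid, the superposed configuration consists of `simCfg (M.init x)`. -/
theorem superposed_three (M : EParTM A) (x : List A) :
    M.sim.superposed x 3 = {M.simCfg (M.init x)} := by
  have key : ∀ (c : M.sim.Cfg) (i : TMInstr M.sim.Q M.sim.Γ), M.SimInstr i → i.Matches c →
      i.stateInc = false → i.symbolInc = false →
      (∀ j, M.SimInstr j → j.Matches c → j.apply c = i.apply c) →
      M.sim.step {c} = {i.apply c} := by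
    intro c i hi hm h1 h2 hu
    ext c'
    constructor
    · rintro ⟨d, rfl, ⟨j, hj, he, rfl⟩ | ⟨hn, -⟩⟩
      · exact hu j hj he.1
      · exact absurd (executable_of_matches hm h1 h2) (hn i hi)
    · rintro rfl
      exact ⟨c, rfl, .inl ⟨i, hi, executable_of_matches hm h1 h2, rfl⟩⟩
  have h0 : M.sim.init x = ⟨.leave, 0, fun y => .sym ((M.init x).tape y)⟩ := by
    simp only [init, sim, TMConfig.mk.injEq, true_and]
    funext y
    split_ifs
    · cases x[y.toNat]? <;> rfl
    · rfl
  have e1 : M.sim.superposed x 1 = {⟨.lay, -1, fun y => .sym ((M.init x).tape y)⟩} := by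
    change M.sim.step {M.sim.init x} = _
    rw [h0, key _ _ (.leave _) ⟨rfl, rfl⟩ rfl rfl]
    · rfl
    · intro j hj hm
      cases hj with
      | leave s => rfl
      | _ => cases hm.1
  have hblank : ∀ y < 0, (M.init x).tape y = M.blank := by
    intro y hy
    simp [init, hy]
  have e2 : M.sim.superposed x 2 = {⟨.enter, -1, spread (M.init x).tape false⟩} := by
    change M.sim.step (M.sim.superposed x 1) = _
    rw [e1, key _ _ (.lay _) ⟨rfl, rfl⟩ rfl rfl]
    · simp only [TMInstr.apply, Set.singleton_eq_singleton_iff, TMConfig.mk.injEq, true_and]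
      funext y
      by_cases hy : y = -1
      · subst hy; simp
      · simp only [Function.update_of_ne hy, spread, hy, if_false]
        split_ifs with h
        · rw [hblank y h, hblank (y + 1) (by omega)]
        · rfl
    · intro j hj hm
      cases hj with
      | lay s => rfl
      | _ => cases hm.1
  change M.sim.step (M.sim.superposed x 2) = _
  rw [e2, key _ _ .enter ⟨rfl, by simp⟩ rfl rfl]
  · rfl
  · intro j hj hm
    cases hj with
    | enter => rfl
    | _ => cases hm.1

theorem phase_of_mem_superposed (M : EParTM A) (x : List A) (τ : ℕ) :
    ∀ c ∈ M.sim.superposed x (τ + 3), M.Phase x τ c := by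
  induction τ with
  | zero =>
    rw [zero_add, superposed_three]
    rintro c rfl
    exact .run 0 _ rfl (by simp)
  | succ τ ih =>
    rintro c' ⟨c, hc, ⟨i, hi, he, rfl⟩ | ⟨hn, rfl⟩⟩
    · exact Phase.apply ih hc hi he
    · rcases (ih _ hc).exists_executable (M.sim.superposed x (τ + 3)) with ⟨i, hi, he⟩ | h
      · exact absurd he (hn i hi)
      · exact (ih _ hc).of_final h

theorem apply_mem_superposed {M : EParTM A} {x : List A} {t : ℕ} {c : M.Cfg}
    (hc : c ∈ M.superposed x t) {i : TMInstr M.Q M.Γ} (hi : i ∈ M.instrs) (hm : i.Matches c)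
    (h1 : i.stateInc = false) (h2 : i.symbolInc = false) :
    i.apply c ∈ M.superposed x (t + 1) :=
  ⟨c, hc, .inl ⟨i, hi, executable_of_matches hm h1 h2, rfl⟩⟩

theorem exists_simCfg_mem_superposed (M : EParTM A) (x : List A) (k : ℕ) (m : M.Cfg)
    (hm : m ∈ M.reach x k) : ∃ τ ≤ 2 * k, M.simCfg m ∈ M.sim.superposed x (τ + 3) := by
  induction k generalizing m with
  | zero =>
    obtain rfl : m = M.init x := hm
    exact ⟨0, by simp, by rw [zero_add, superposed_three]; rfl⟩
  | succ k ih =>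
    obtain ⟨c, hc, i, hi, hmat, rfl⟩ := hm
    obtain ⟨τ, hk, hτ⟩ := ih c hc
    have h1 := apply_mem_superposed hτ (SimInstr.exec i hi (leftOf c.pos))
      ⟨by simp [simCfg, hmat.1], by simp [simCfg, hmat.2]⟩ rfl rfl
    rcases M.apply_exec c i with h | ⟨hp, h⟩
    · rw [h] at h1
      exact ⟨τ + 1, by omega, h1⟩
    · rw [h] at h1
      have h2 := apply_mem_superposed h1 (SimInstr.cross _ _) ⟨rfl, by simp⟩ rfl rfl
      rw [apply_cross M _ hp] at h2
      exact ⟨τ + 2, by omega, h2⟩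

/-- An accepting path puts a member with a raised flag into the superposed configuration, and this
member stays. -/
theorem exists_flag_of_haltsIn (M : EParTM A) (x : List A) (k : ℕ) (m : M.Cfg)
    (h : M.HaltsIn x k m) (hacc : m.state = M.accept) :
    ∀ t ≥ 3 * k + 6, (⟨.yes, -1, spread m.tape true⟩ : M.sim.Cfg) ∈ M.sim.superposed x t := by
  obtain ⟨hm, hh⟩ := h
  obtain ⟨τ, hk, hτ⟩ := M.exists_simCfg_mem_superposed x k m hm
  have h0 := apply_mem_superposed hτ
    (SimInstr.halt m.state (m.tape m.pos) (fun i hi h1 h2 => hh i hi ⟨h1.symm, h2.symm⟩)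
      (leftOf m.pos)) ⟨by simp [simCfg], by simp [simCfg]⟩ rfl rfl
  have hwalk : ∀ (left : Bool) (d t : ℕ), (⟨.back true left, if left then -1 - (d : ℤ) else -1 + d,
      spread m.tape false⟩ : M.sim.Cfg) ∈ M.sim.superposed x t →
      (⟨.yes, -1, spread m.tape true⟩ : M.sim.Cfg) ∈ M.sim.superposed x (t + d + 1) := by
    intro left d
    induction d with
    | zero =>
      intro t ht
      convert apply_mem_superposed ht (SimInstr.record left) ⟨rfl, by simp⟩ rfl rfl using 1
      simp [TMInstr.apply, update_spread_flag]
    | succ d ih =>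
      intro t ht
      obtain ⟨s, hs⟩ := spread_of_ne m.tape false
        (y := if left then -1 - ((d + 1 : ℕ) : ℤ) else -1 + (d + 1 : ℕ)) (by split_ifs <;> omega)
      rw [show t + (d + 1) + 1 = t + 1 + d + 1 by ring]
      refine ih (t + 1) ?_
      convert apply_mem_superposed ht (SimInstr.home true left s) ⟨rfl, hs⟩ rfl rfl using 1
      cases left <;> simp [TMInstr.apply, TMAction.toward] <;> ring
  obtain ⟨d, hd, hpl⟩ := exists_place_eq (M.abs_pos_le_of_mem_reach x k m hm)
  have ht := hwalk (leftOf m.pos) d (τ + 3 + 1) (by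
    convert h0 using 1
    simp only [TMInstr.apply, simCfg, update_spread_place, Function.update_eq_self, hacc,
      decide_true]
    rw [hpl])
  intro t' ht'
  replace ht' : τ + 3 + 1 + d + 1 ≤ t' := by omega
  induction t', ht' using Nat.le_induction with
  | base => exact ht
  | succ t' _ ih =>
    refine ⟨_, ih, .inr ⟨fun i hi he => ?_, rfl⟩⟩
    have h1 := he.1.1
    cases hi <;> simp at h1

theorem prob_eq_one (M : EParTM A) (x : List A) (t : ℕ) (q : M.Q)
    (h : ∀ c ∈ M.superposed x t, c.state = q) : M.prob (M.superposed x t) q = 1 := by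
  have : {c ∈ M.superposed x t | c.state = q} = M.superposed x t := by
    ext c
    exact ⟨fun hc => hc.1, fun hc => ⟨hc, h c hc⟩⟩
  rw [prob, this, div_self]
  have := (Set.ncard_pos (M.superposed_finite x t)).mpr (M.superposed_nonempty x t)
  positivity

theorem sim_decidesInTime (M : EParTM A) (L : Language A) (T : ℕ → ℕ)
    (h : M.NDDecidesInTime L T) : M.sim.DecidesInTime L 0 (fun n => 3 * T n + 8) := by
  intro x
  obtain ⟨hT, hL⟩ := h x
  have hacc : x ∈ L ↔ M.NDAccepts x := by
    rw [hL]
    exact ⟨fun ⟨n, c, hc, hh, ha⟩ => ⟨n, c, ⟨hc, hh⟩, ha⟩,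
      fun ⟨n, c, ⟨hc, hh⟩, ha⟩ => ⟨n, c, hc, hh, ha⟩⟩
  -- From time `3 * T + 7` on, the bounds in `Phase` leave only the accepting and rejecting states.
  have hfin : ∀ τ ≥ 3 * T x.length + 4, ∀ c ∈ M.sim.superposed x (τ + 3),
      c.state = SimState.yes ∨ c.state = SimState.no := by
    intro τ hτ c hc
    cases M.phase_of_mem_superposed x τ c hc with
    | run k m hm h => have := hT k ⟨m, hm⟩; omega
    | cross k m hm h => have := hT k ⟨m, hm⟩; omega
    | back k m hm left d h => have := hT k ⟨m, hm.1⟩; omega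
    | yes => simp
    | no => simp
    | converted => simp
  have hstops : ∀ t, (∀ c ∈ M.sim.superposed x t, c.state = SimState.yes) →
      M.sim.Stops (M.sim.superposed x t) := by
    intro t ht c hc i hi he
    have h1 := he.1.1
    rw [ht c hc] at h1
    cases hi <;> cases h1
  by_cases hx : M.NDAccepts x
  · have hx' := hx
    obtain ⟨k, m, hm, hma⟩ := hx
    have hk := hT k ⟨m, hm.1⟩
    have hflag := M.exists_flag_of_haltsIn x k m hm hma
    have hyes : ∀ c ∈ M.sim.superposed x (3 * T x.length + 8), c.state = SimState.yes := by
      rintro c' ⟨c, hc, h⟩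
      rcases h with ⟨i, hi, he, rfl⟩ | ⟨hn, rfl⟩
      · have h1 := he.1.1
        rcases hfin _ le_rfl c hc with h2 | h2 <;> rw [h2] at h1 <;> cases hi <;>
          first | rfl | cases h1
      · cases M.phase_of_mem_superposed x (3 * T x.length + 4) c' hc with
        | yes => rfl
        | converted => rfl
        | no T' =>
          refine absurd ⟨⟨rfl, by simp⟩, by simp, fun _ => ⟨_, hc, _, hflag _ (by omega), ?_⟩⟩
            (hn _ .convert)
          simp
        | _ => have h2 := hfin _ le_rfl _ hc; simp [simCfg] at h2
    refine ⟨3 * T x.length + 8, le_rfl, hstops _ hyes, fun c hc => .inl (hyes c hc), fun _ => ?_,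
      fun h => absurd (hacc.mpr hx') h⟩
    rw [prob_eq_one _ _ _ _ hyes]
    norm_num
  · have hno : ∀ τ ≥ 3 * T x.length + 4, ∀ c ∈ M.sim.superposed x (τ + 3),
        c.state = SimState.no ∧ c.pos = -1 ∧ c.tape (-1) = .flag false := by
      intro τ hτ c hc
      have h1 := hfin τ hτ c hc
      cases M.phase_of_mem_superposed x τ c hc with
      | yes k m hm h => exact absurd ⟨k, m, hm, h⟩ hx
      | converted T h => exact absurd h hx
      | no => simp
      | _ => simp [simCfg] at h1
    refine ⟨3 * T x.length + 4 + 3, by simp, ?_, fun c hc => .inr (hno _ le_rfl c hc).1,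
      fun h => absurd (hacc.mp h) hx, fun _ => ?_⟩
    · intro c hc i hi he
      obtain ⟨h1, h2, -⟩ := hno _ le_rfl c hc
      have h3 := he.1.1
      rw [h1] at h3
      cases hi with
      | convert =>
        obtain ⟨d, hd, e, he, hne⟩ := he.2.2 rfl
        rw [h2, (hno _ le_rfl d hd).2.2, (hno _ le_rfl e he).2.2] at hne
        exact hne rfl
      | _ => cases h3
    · rw [prob_eq_one _ _ _ _ fun c hc => (hno _ le_rfl c hc).1]
      norm_num

end EParTM

/-! ### Iterated sweeps over a word -/

/-- A nondeterministic device that works in passes.  In each pass it reads its word from left to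
right, replacing every letter by another one and updating a state; at the right end it may accept,
or start a new pass over the word it has produced. -/
structure Sweeper (A : Type) where
  State : Type
  Letter : Type
  finiteState : Finite State
  finiteLetter : Finite Letter
  embed : A → Letter
  embed_injective : Function.Injective embed
  start : State
  /-- The possible new states and replacement letters. -/
  trans : State → Letter → Set (State × Letter)
  /-- The states at a right end after which a new pass starts, and its initial states. -/
  next : State → State → Prop
  /-- The states that accept at a right end. -/
  acc : State → Prop

namespace Sweeper

variable {A : Type} (W : Sweeper A)

/-- Starting in state `q`, reading `u` may end in state `q'` and produce `v`. -/
def Run : W.State → List W.Letter → List W.Letter → W.State → Prop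
  | q, [], v, q' => v = [] ∧ q' = q
  | q, a :: u, v, q' => ∃ q₁ b v₁, (q₁, b) ∈ W.trans q a ∧ Run q₁ u v₁ q' ∧ v = b :: v₁

variable {W}

theorem run_append {q q' : W.State} {u₁ u₂ v : List W.Letter} :
    W.Run q (u₁ ++ u₂) v q' ↔
      ∃ q₁ v₁ v₂, W.Run q u₁ v₁ q₁ ∧ W.Run q₁ u₂ v₂ q' ∧ v = v₁ ++ v₂ := by
  induction u₁ generalizing q v with
  | nil =>
    constructor
    · exact fun h => ⟨q, [], v, ⟨rfl, rfl⟩, h, rfl⟩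
    · rintro ⟨q₁, v₁, v₂, ⟨rfl, rfl⟩, h, rfl⟩
      exact h
  | cons a u ih =>
    constructor
    · rintro ⟨q₁, b, v', hb, hr, rfl⟩
      obtain ⟨q₂, v₁, v₂, h1, h2, rfl⟩ := ih.mp hr
      exact ⟨q₂, b :: v₁, v₂, ⟨q₁, b, v₁, hb, h1, rfl⟩, h2, rfl⟩
    · rintro ⟨q₂, _, v₂, ⟨q₁, b, v₁, hb, h1, rfl⟩, h2, rfl⟩
      exact ⟨q₁, b, v₁ ++ v₂, hb, ih.mpr ⟨q₂, v₁, v₂, h1, h2, rfl⟩, rfl⟩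

theorem run_singleton {q q' : W.State} {a : W.Letter} {v : List W.Letter} :
    W.Run q [a] v q' ↔ ∃ b, (q', b) ∈ W.trans q a ∧ v = [b] := by
  constructor
  · rintro ⟨q₁, b, v₁, hb, ⟨rfl, rfl⟩, rfl⟩
    exact ⟨b, hb, rfl⟩
  · rintro ⟨b, hb, rfl⟩
    exact ⟨q', b, [], hb, ⟨rfl, rfl⟩, rfl⟩

theorem Run.length_eq {q q' : W.State} {u v : List W.Letter} (h : W.Run q u v q') :
    v.length = u.length := by
  induction u generalizing q v with
  | nil => obtain ⟨rfl, -⟩ := h; rfl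
  | cons a u ih =>
    obtain ⟨q₁, b, v₁, -, hr, rfl⟩ := h
    simp [ih hr]

variable (W)

/-- After `k` passes, the word `u` may have been produced, with a new pass to begin in state `q`. -/
inductive Passes (x : List A) : ℕ → List W.Letter → W.State → Prop
  | zero : Passes x 0 (x.map W.embed) W.start
  | succ {k u q v q₁ q₂} (h : Passes x k u q) (hr : W.Run q u v q₁) (hn : W.next q₁ q₂) :
      Passes x (k + 1) v q₂

/-- A pass over `u` begun in state `q` may lead to acceptance, at once or after further passes. -/
inductive Accepts : W.State → List W.Letter → Prop
  | done {q u v q₁} (hr : W.Run q u v q₁) (ha : W.acc q₁) : Accepts q u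
  | pass {q u v q₁ q₂} (hr : W.Run q u v q₁) (hn : W.next q₁ q₂) (h : Accepts q₂ v) : Accepts q u

/-- The accepted language. -/
def language : Language A := {x | W.Accepts W.start (x.map W.embed)}

variable {W}

theorem Passes.length_eq {x : List A} {k : ℕ} {u : List W.Letter} {q : W.State}
    (h : W.Passes x k u q) : u.length = x.length := by
  induction h with
  | zero => simp
  | succ _ hr _ ih => rw [hr.length_eq, ih]

theorem Passes.accepts {x : List A} {k : ℕ} {u : List W.Letter} {q : W.State}
    (h : W.Passes x k u q) (ha : W.Accepts q u) : W.Accepts W.start (x.map W.embed) := by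
  induction h with
  | zero => exact ha
  | succ _ hr hn ih => exact ih (.pass hr hn ha)

theorem accepts_iff {q : W.State} {u : List W.Letter} :
    W.Accepts q u ↔
      ∃ v q₁, W.Run q u v q₁ ∧ (W.acc q₁ ∨ ∃ q₂, W.next q₁ q₂ ∧ W.Accepts q₂ v) := by
  constructor
  · rintro (⟨hr, ha⟩ | ⟨hr, hn, h⟩)
    exacts [⟨_, _, hr, .inl ha⟩, ⟨_, _, hr, .inr ⟨_, hn, h⟩⟩]
  · rintro ⟨v, q₁, hr, ha | ⟨q₂, hn, h⟩⟩
    exacts [.done hr ha, .pass hr hn h]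

/-- States of the machine that carries out the sweeps: about to read a letter, about to move on to
the next one, on the way back to the left end for a pass that starts in state `q`, and the two
outcomes (`no` is never entered: a path that does not accept gets stuck). -/
inductive MState (σ : Type) where
  | read (q : σ)
  | move (q : σ)
  | back (q : σ)
  | yes
  | no

instance {σ : Type} [Finite σ] : Finite (MState σ) :=
  Finite.of_surjective (fun s : σ ⊕ σ ⊕ σ ⊕ Bool =>
    match s with
    | .inl q => MState.read q
    | .inr (.inl q) => .move q
    | .inr (.inr (.inl q)) => .back q
    | .inr (.inr (.inr true)) => .yes
    | .inr (.inr (.inr false)) => .no) <| by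
    rintro (q | q | q | _ | _)
    exacts [⟨.inl q, rfl⟩, ⟨.inr (.inl q), rfl⟩, ⟨.inr (.inr (.inl q)), rfl⟩,
      ⟨.inr (.inr (.inr true)), rfl⟩, ⟨.inr (.inr (.inr false)), rfl⟩]

/-- The instructions of the machine that carries out the sweeps; `none` is the blank. -/
inductive MInstr (W : Sweeper A) : TMInstr (MState W.State) (Option W.Letter) → Prop
  | replace (q a q' b) (h : (q', b) ∈ W.trans q a) :
      MInstr W ⟨.read q, false, some a, false, .write (some b), .move q'⟩
  | advance (q a) : MInstr W ⟨.move q, false, some a, false, .right, .read q⟩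
  | turn (q q') (h : W.next q q') : MInstr W ⟨.read q, false, none, false, .left, .back q'⟩
  | accept (q) (h : W.acc q) : MInstr W ⟨.read q, false, none, false, .write none, .yes⟩
  | rewind (q a) : MInstr W ⟨.back q, false, some a, false, .left, .back q⟩
  | restart (q) : MInstr W ⟨.back q, false, none, false, .right, .read q⟩

/-- The Turing machine that carries out the sweeps. -/
abbrev machine (W : Sweeper A) : EParTM A where
  Q := MState W.State
  Γ := Option W.Letter
  finiteQ := by have := W.finiteState; infer_instance
  finiteΓ := by have := W.finiteLetter; infer_instance
  blank := none
  embed a := some (W.embed a)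
  embed_injective a b h := W.embed_injective (by simpa using h)
  embed_ne_blank a := by simp
  start := .read W.start
  accept := .yes
  reject := .no
  accept_ne_reject := by simp
  instrs := {i | MInstr W i}

theorem isNDTM_machine (W : Sweeper A) : W.machine.IsNDTM := by
  intro i hi
  cases hi <;> exact ⟨rfl, rfl⟩

/-- The tape that holds the word `u` on the cells `0, 1, …`. -/
def wordTape {Λ : Type} (u : List Λ) (y : ℤ) : Option Λ := if 0 ≤ y then u[y.toNat]? else none

@[simp]
theorem wordTape_natCast {Λ : Type} (u : List Λ) (j : ℕ) : wordTape u j = u[j]? := by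
  simp [wordTape]

theorem wordTape_of_neg {Λ : Type} (u : List Λ) {y : ℤ} (hy : y < 0) : wordTape u y = none := by
  simp [wordTape, hy]

theorem update_wordTape {Λ : Type} (u v : List Λ) (a b : Λ) :
    Function.update (wordTape (u ++ a :: v)) u.length (some b) = wordTape (u ++ b :: v) := by
  funext y
  by_cases hy : 0 ≤ y
  · lift y to ℕ using hy
    rw [Function.update_apply]
    split_ifs with h
    · obtain rfl : y = u.length := by exact_mod_cast h
      simp
    · have h' : y ≠ u.length := by exact_mod_cast h
      simp only [wordTape_natCast]
      rcases lt_or_gt_of_ne h' with h1 | h1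
      · simp [List.getElem?_append_left h1]
      · obtain ⟨d, rfl⟩ : ∃ d, y = u.length + (d + 1) := ⟨y - u.length - 1, by omega⟩
        rw [List.getElem?_append_right (by omega), List.getElem?_append_right (by omega)]
        simp
  · rw [Function.update_of_ne (by omega), wordTape_of_neg _ (by omega),
      wordTape_of_neg _ (by omega)]

theorem init_machine (W : Sweeper A) (x : List A) :
    W.machine.init x = ⟨.read W.start, 0, wordTape (x.map W.embed)⟩ := by
  refine congrArg (TMConfig.mk _ _) ?_
  funext y
  unfold wordTape
  split_ifs
  · rw [List.getElem?_map]
    cases x[y.toNat]? <;> rfl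
  · rfl

/-- What a configuration at the end of a computation path of length `n` looks like.  The bounds on
`n` say that a pass takes `3 * |x| + 2` steps: two for each letter, one to turn, one for each
letter on the way back, and one to start again. -/
inductive Stage (W : Sweeper A) (x : List A) (n : ℕ) : W.machine.Cfg → Prop
  | read (k u q₀ u₁ v post q) (h : W.Passes x k u q₀) (hu : u = u₁ ++ post)
      (hr : W.Run q₀ u₁ v q) (hn : n ≤ k * (3 * x.length + 2) + 2 * u₁.length) :
      Stage W x n ⟨.read q, v.length, wordTape (v ++ post)⟩
  | move (k u q₀ u₁ v a b post q) (h : W.Passes x k u q₀) (hu : u = u₁ ++ a :: post)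
      (hr : W.Run q₀ (u₁ ++ [a]) (v ++ [b]) q)
      (hn : n ≤ k * (3 * x.length + 2) + 2 * u₁.length + 1) :
      Stage W x n ⟨.move q, v.length, wordTape (v ++ b :: post)⟩
  | back (k u q) (j : ℕ) (h : W.Passes x (k + 1) u q) (hj : j ≤ x.length)
      (hn : n + j ≤ k * (3 * x.length + 2) + 3 * x.length + 1) :
      Stage W x n ⟨.back q, (j : ℤ) - 1, wordTape u⟩
  | yes (k u q₀ v q) (h : W.Passes x k u q₀) (hr : W.Run q₀ u v q) (ha : W.acc q)
      (hn : n ≤ k * (3 * x.length + 2) + 2 * x.length + 1) :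
      Stage W x n ⟨.yes, v.length, wordTape v⟩

theorem stage_of_mem_reach (W : Sweeper A) (x : List A) (n : ℕ) :
    ∀ c ∈ W.machine.reach x n, Stage W x n c := by
  induction n with
  | zero =>
    intro c hc
    obtain rfl : c = W.machine.init x := hc
    rw [init_machine]
    exact .read 0 _ _ [] [] _ _ .zero rfl ⟨rfl, rfl⟩ (by simp)
  | succ n ih =>
    rintro c' ⟨c, hc, i, hi, ⟨hm1, hm2⟩, rfl⟩
    cases ih c hc with
    | read k u q₀ u₁ v post q h hu hr hn =>
      have hlen := hr.length_eq
      have hlx := h.length_eq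
      cases hi with
      | replace q a q' b ht =>
        cases hm1
        simp only [wordTape_natCast] at hm2
        obtain ⟨post', rfl⟩ : ∃ post', post = a :: post' := by
          cases post with
          | nil => simp at hm2
          | cons a' post' =>
            obtain rfl : a' = a := by simpa using hm2
            exact ⟨post', rfl⟩
        have hr' : W.Run q₀ (u₁ ++ [a]) (v ++ [b]) q' :=
          run_append.mpr ⟨_, _, _, hr, run_singleton.mpr ⟨b, ht, rfl⟩, rfl⟩
        simp only [TMInstr.apply, update_wordTape]
        exact .move k u q₀ u₁ v a b post' q' h hu hr' (by omega)
      | turn q q' ht =>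
        cases hm1
        simp only [wordTape_natCast] at hm2
        obtain rfl : post = [] := by
          cases post with
          | nil => rfl
          | cons a' post' => simp at hm2
        simp only [List.append_nil] at hu ⊢
        subst hu
        simp only [TMInstr.apply]
        refine .back k v q' v.length (.succ h hr ht) (by omega) ?_
        rw [hlen, hlx] at *
        omega
      | accept q ha =>
        cases hm1
        simp only [wordTape_natCast] at hm2
        obtain rfl : post = [] := by
          cases post with
          | nil => rfl
          | cons a' post' => simp at hm2
        simp only [List.append_nil] at hu ⊢
        subst hu
        have hupd : Function.update (wordTape v) v.length none = wordTape v := by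
          conv_rhs => rw [← Function.update_eq_self (v.length : ℤ) (wordTape v)]
          simp
        simp only [TMInstr.apply, hupd]
        exact .yes k _ q₀ v q h hr ha (by omega)
      | _ => cases hm1
    | move k u q₀ u₁ v a b post q h hu hr hn =>
      have hlen := hr.length_eq
      cases hi with
      | advance q a' =>
        cases hm1
        have := Stage.read (n := n + 1) k u q₀ (u₁ ++ [a]) (v ++ [b]) post q h (by simp [hu]) hr
          (by simp; omega)
        convert this using 1
        simp [TMInstr.apply]
      | _ => cases hm1
    | back k u q j h hj hn =>
      have hlx := h.length_eq
      cases hi with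
      | rewind q a =>
        cases hm1
        cases j with
        | zero => simp [wordTape] at hm2
        | succ j =>
          convert Stage.back (n := n + 1) k u q j h (by omega) (by omega) using 1
          simp [TMInstr.apply]
      | restart q =>
        cases hm1
        cases j with
        | zero =>
          convert Stage.read (n := n + 1) (k + 1) u q [] [] u q h rfl ⟨rfl, rfl⟩
            (by rw [add_mul]; simp; omega) using 1
          simp [TMInstr.apply]
        | succ j =>
          simp [show j < u.length by omega] at hm2
      | _ => cases hm1
    | yes k u q₀ v q h hr ha hn =>
      cases hi <;> cases hm1

theorem apply_mem_reach {M : EParTM A} {x : List A} {n : ℕ} {c : M.Cfg} (hc : c ∈ M.reach x n)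
    {i : TMInstr M.Q M.Γ} (hi : i ∈ M.instrs) (hm : i.Matches c) :
    i.apply c ∈ M.reach x (n + 1) :=
  ⟨c, hc, i, hi, hm, rfl⟩

/-- The machine can follow a run of the sweeping device over a part of the word. -/
theorem exists_reach_of_run {W : Sweeper A} {x : List A} (u : List W.Letter)
    {pre v post : List W.Letter} {q q' : W.State} {n : ℕ}
    (hc : (⟨.read q, pre.length, wordTape (pre ++ (u ++ post))⟩ : W.machine.Cfg) ∈
      W.machine.reach x n) (hr : W.Run q u v q') :
    ∃ n', (⟨.read q', (pre ++ v).length, wordTape (pre ++ (v ++ post))⟩ : W.machine.Cfg) ∈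
      W.machine.reach x n' := by
  induction u generalizing pre v q n with
  | nil =>
    obtain ⟨rfl, rfl⟩ := hr
    exact ⟨n, by simpa using hc⟩
  | cons a u ih =>
    obtain ⟨q₁, b, v₁, hb, hr, rfl⟩ := hr
    have h1 := apply_mem_reach hc (MInstr.replace q a q₁ b hb) ⟨rfl, by simp⟩
    simp only [TMInstr.apply, List.cons_append, update_wordTape] at h1
    have h2 := apply_mem_reach h1 (MInstr.advance q₁ b) ⟨rfl, by simp⟩
    obtain ⟨n', h3⟩ := ih (pre := pre ++ [b]) (by convert h2 using 1; simp [TMInstr.apply]) hr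
    exact ⟨n', by simpa using h3⟩

theorem exists_reach_read_of_back {W : Sweeper A} {x : List A} (u : List W.Letter) (q : W.State)
    (j n : ℕ) (hj : j ≤ u.length)
    (hc : (⟨.back q, (j : ℤ) - 1, wordTape u⟩ : W.machine.Cfg) ∈ W.machine.reach x n) :
    ∃ n', (⟨.read q, 0, wordTape u⟩ : W.machine.Cfg) ∈ W.machine.reach x n' := by
  induction j generalizing n with
  | zero =>
    have h1 := apply_mem_reach hc (MInstr.restart q) ⟨rfl, by simp [wordTape]⟩
    exact ⟨n + 1, by simpa [TMInstr.apply] using h1⟩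
  | succ j ih =>
    have h1 := apply_mem_reach hc (MInstr.rewind q u[j]) ⟨rfl, by simp⟩
    exact ih (n + 1) (by omega) (by simpa [TMInstr.apply] using h1)

theorem exists_reach_yes_of_accepts {W : Sweeper A} {x : List A} {q : W.State}
    {u : List W.Letter} (h : W.Accepts q u) (n : ℕ)
    (hc : (⟨.read q, 0, wordTape u⟩ : W.machine.Cfg) ∈ W.machine.reach x n) :
    ∃ n, ∃ c ∈ W.machine.reach x n, c.state = .yes := by
  induction h generalizing n with
  | @done q u v q₁ hr ha =>
    obtain ⟨n', h1⟩ := exists_reach_of_run u (pre := []) (post := []) (by simpa using hc) hr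
    exact ⟨n' + 1, _, apply_mem_reach h1 (MInstr.accept q₁ ha) ⟨rfl, by simp⟩, rfl⟩
  | @pass q u v q₁ q₂ hr hn h ih =>
    obtain ⟨n', h1⟩ := exists_reach_of_run u (pre := []) (post := []) (by simpa using hc) hr
    have h2 := apply_mem_reach h1 (MInstr.turn q₁ q₂ hn) ⟨rfl, by simp⟩
    obtain ⟨n'', h3⟩ := exists_reach_read_of_back v q₂ v.length (n' + 1) le_rfl
      (by simpa [TMInstr.apply] using h2)
    exact ih n'' h3

/-- A sweeping device that makes at most `B |x|` passes is carried out by an NDTM in the time that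
this suggests. -/
theorem ndDecidesInTime_machine (W : Sweeper A) (B : ℕ → ℕ)
    (hB : ∀ x k u q, W.Passes x k u q → k ≤ B x.length) :
    W.machine.NDDecidesInTime W.language
      (fun n => B n * (3 * n + 2) + (3 * n + 1)) := by
  intro x
  have hyes : ∀ n, ∀ c ∈ W.machine.reach x n, c.state = .yes →
      W.Accepts W.start (x.map W.embed) := by
    intro n c hc hy
    cases W.stage_of_mem_reach x n c hc with
    | yes k u q₀ v q h hr ha hn => exact h.accepts (.done hr ha)
    | _ => cases hy
  constructor
  · rintro n ⟨c, hc⟩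
    change n ≤ B x.length * (3 * x.length + 2) + (3 * x.length + 1)
    have hmul : ∀ k ≤ B x.length, k * (3 * x.length + 2) ≤ B x.length * (3 * x.length + 2) :=
      fun k hk => Nat.mul_le_mul_right _ hk
    cases W.stage_of_mem_reach x n c hc with
    | read k u q₀ u₁ v post q h hu hr hn =>
      have := hmul k (hB x k u q₀ h)
      have hl := h.length_eq
      simp [hu] at hl
      omega
    | move k u q₀ u₁ v a b post q h hu hr hn =>
      have := hmul k (hB x k u q₀ h)
      have hl := h.length_eq
      simp [hu] at hl
      omega
    | back k u q j h hj hn =>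
      have := hmul k ((Nat.le_succ k).trans (hB x _ u q h))
      omega
    | yes k u q₀ v q h hr ha hn =>
      have := hmul k (hB x k u q₀ h)
      omega
  · constructor
    · intro h
      obtain ⟨n, c, hc, hy⟩ := exists_reach_yes_of_accepts h 0 (init_machine W x).symm
      refine ⟨n, c, hc, ?_, hy⟩
      rintro i hi ⟨hm, -⟩
      rw [hy] at hm
      cases hi <;> cases hm
    · rintro ⟨n, c, hc, -, hy⟩
      exact hyes n c hc hy

end Sweeper

/-! ### A sweeping device for CSAT -/

/-- The progress of the comparison of a letter with the current target: not yet compared, found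
equal, or found different. -/
inductive Mark where
  | fresh
  | used
  | off

/-- What is known about the choice of a literal in the clause being read: it is still to be made,
the literal being read is chosen, or a literal to the left has been chosen. -/
inductive Choice where
  | pending
  | current
  | settled

/-- Letters of the sweeping device for CSAT: the input letters, an erased letter, the sign of a
chosen literal, and a letter of a chosen index, where `none` is the end mark of the index. -/
inductive CSATLetter where
  | raw (s : CNFSymbol)
  | skip
  | sign (b : Bool)
  | digit (a : Option Bool) (m : Mark)

/-- States of the sweeping device for CSAT.  In the first pass: at the start of a clause, or
inside a literal, where `zero` says that the last letter was the bit `0`.  In the later passes: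
looking for the target, where `s` is the last sign; or comparing its first letter `a` with the
indices of the other literals, where `s` is the sign of the target, `t` the last sign, and `active`
says that the letter to be compared with `a` has still to be found. -/
inductive CSATState where
  | clause
  | literal (sel : Choice) (zero : Bool)
  | find (s : Bool)
  | compare (s : Bool) (a : Option Bool) (t : Bool) (active : Bool)

instance : Finite Mark :=
  Finite.of_surjective (![.fresh, .used, .off] : Fin 3 → Mark) <| by
    rintro (_ | _ | _)
    exacts [⟨0, rfl⟩, ⟨1, rfl⟩, ⟨2, rfl⟩]

instance : Finite Choice :=
  Finite.of_surjective (![.pending, .current, .settled] : Fin 3 → Choice) <| by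
    rintro (_ | _ | _)
    exacts [⟨0, rfl⟩, ⟨1, rfl⟩, ⟨2, rfl⟩]

instance : Finite CNFSymbol :=
  Finite.of_surjective (fun s : Fin 3 ⊕ Bool => s.elim ![.pos, .neg, .close] .bit) <| by
    rintro (_ | _ | b | _)
    exacts [⟨.inl 0, rfl⟩, ⟨.inl 1, rfl⟩, ⟨.inr b, rfl⟩, ⟨.inl 2, rfl⟩]

instance : Finite CSATLetter :=
  Finite.of_surjective (fun s : (CNFSymbol ⊕ Unit) ⊕ Bool ⊕ Option Bool × Mark =>
    s.elim (Sum.elim .raw fun _ => .skip) (Sum.elim .sign fun p => .digit p.1 p.2)) <| by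
    rintro (s | _ | b | ⟨a, m⟩)
    exacts [⟨.inl (.inl s), rfl⟩, ⟨.inl (.inr ()), rfl⟩, ⟨.inr (.inl b), rfl⟩,
      ⟨.inr (.inr (a, m)), rfl⟩]

instance : Finite CSATState :=
  Finite.of_surjective
    (fun s : (Unit ⊕ Choice × Bool) ⊕ Bool ⊕ Bool × Option Bool × Bool × Bool =>
      s.elim (Sum.elim (fun _ => .clause) fun p => .literal p.1 p.2)
        (Sum.elim .find fun p => .compare p.1 p.2.1 p.2.2.1 p.2.2.2)) <| by
    rintro (_ | ⟨c, z⟩ | s | ⟨s, a, t, k⟩)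
    exacts [⟨.inl (.inl ()), rfl⟩, ⟨.inl (.inr (c, z)), rfl⟩, ⟨.inr (.inl s), rfl⟩,
      ⟨.inr (.inr (s, a, t, k)), rfl⟩]

/-- The mark that the letter of an index gets when it has been compared with the letter `a` of the
target.  Comparison with the end mark is the last one, and so removes all marks. -/
def Mark.after (a : Option Bool) (m : Mark) : Mark := if a = none then .fresh else m

/-- The first pass: check that the word is the code of a formula, choose a literal in each clause,
and erase everything else, except that the letter behind a chosen literal becomes an end mark. -/
def csatChoose : Choice → CNFSymbol → List (CSATState × CSATLetter)
  | .pending, .pos => [(.literal .pending false, .skip), (.literal .current false, .sign true)]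
  | .pending, .neg => [(.literal .pending false, .skip), (.literal .current false, .sign false)]
  | .current, .pos => [(.literal .settled false, .digit none .fresh)]
  | .current, .neg => [(.literal .settled false, .digit none .fresh)]
  | .current, .close => [(.clause, .digit none .fresh)]
  | .settled, .pos => [(.literal .settled false, .skip)]
  | .settled, .neg => [(.literal .settled false, .skip)]
  | .settled, .close => [(.clause, .skip)]
  | _, _ => []

/-- The transitions of the sweeping device for CSAT. -/
def csatTrans : CSATState → CSATLetter → List (CSATState × CSATLetter)
  | .clause, .raw .pos => csatChoose .pending .pos
  | .clause, .raw .neg => csatChoose .pending .neg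
  | .literal .current _, .raw (.bit b) => [(.literal .current (!b), .digit (some b) .fresh)]
  | .literal sel _, .raw (.bit b) => [(.literal sel (!b), .skip)]
  | .literal sel false, .raw s => csatChoose sel s
  | .find s, .skip => [(.find s, .skip)]
  | .find _, .sign t => [(.find t, .sign t)]
  | .find s, .digit a .fresh => [(.compare s a s false, .skip)]
  | .compare s a t k, .skip => [(.compare s a t k, .skip)]
  | .compare s a _ _, .sign t => [(.compare s a t true, .sign t)]
  | .compare s a t false, .digit b m => [(.compare s a t false, .digit b (m.after a))]
  | .compare s a t true, .digit b .used =>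
      [(.compare s a t true, .digit b (Mark.used.after a))]
  | .compare s a t true, .digit b .off =>
      [(.compare s a t false, .digit b (Mark.off.after a))]
  | .compare s a t true, .digit b .fresh =>
      if b = a then
        -- Equal indices with opposite signs: the choice of literals is contradictory.
        if a = none ∧ t ≠ s then []
        else [(.compare s a t false, .digit b (Mark.used.after a))]
      else [(.compare s a t false, .digit b (Mark.off.after a))]
  | _, _ => []

/-- The sweeping device for CSAT.  Its first pass chooses a literal in each clause.  Each later pass
erases the first letter of the first index left, the target, and marks the first letter not yet
compared of every other index that has agreed with the target so far.  A pass that finds no target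
accepts. -/
abbrev csatSweeper : Sweeper CNFSymbol where
  State := CSATState
  Letter := CSATLetter
  finiteState := inferInstance
  finiteLetter := inferInstance
  embed := .raw
  embed_injective a b h := by simpa using h
  start := .clause
  trans q a := {p | p ∈ csatTrans q a}
  next q q' := q' = .find true ∧ (q = .clause ∨ ∃ s a t k, q = .compare s a t k)
  acc q := ∃ s, q = .find s

namespace CSATLetter

/-- Whether a letter has not been erased. -/
def present : CSATLetter → Bool
  | .skip => false
  | _ => true

/-- What is left of a word when the erased letters are removed. -/
def core (u : List CSATLetter) : List CSATLetter := u.filter present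

@[simp] theorem core_nil : core [] = [] := rfl
@[simp] theorem core_skip (u) : core (skip :: u) = core u := rfl
@[simp] theorem core_raw (s u) : core (raw s :: u) = raw s :: core u := rfl
@[simp] theorem core_sign (s u) : core (sign s :: u) = sign s :: core u := rfl
@[simp] theorem core_digit (a m u) : core (digit a m :: u) = digit a m :: core u := rfl
@[simp] theorem core_append (u v) : core (u ++ v) = core u ++ core v := List.filter_append ..
@[simp] theorem core_core (u) : core (core u) = core u := by simp [core]

@[simp] theorem core_map_digit (l m) : core (List.map (digit · m) l) = l.map (digit · m) := by
  induction l <;> simp_all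

@[simp] theorem core_map_sign (l) : core (List.map sign l) = l.map sign := by
  induction l <;> simp_all

end CSATLetter

open CSATLetter

namespace CSATState

/-- Whether the device is in one of the passes after the first one. -/
def later : CSATState → Bool
  | .find _ => true
  | .compare _ _ _ _ => true
  | _ => false

/-- A letter has been erased in the current pass. -/
def erased : CSATState → ℕ
  | .compare _ _ _ _ => 1
  | _ => 0

end CSATState

theorem csatTrans_skip {q : CSATState} (hq : q.later = true) :
    csatTrans q .skip = [(q, .skip)] := by
  cases q <;> simp_all [CSATState.later, csatTrans]

theorem csatTrans_later {q q' : CSATState} {a b : CSATLetter} (hq : q.later = true)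
    (h : (q', b) ∈ csatTrans q a) :
    q'.later = true ∧ (core [b]).length + q'.erased ≤ (core [a]).length + q.erased := by
  rcases q with _ | ⟨sel, z⟩ | s | ⟨s, c, t, _ | _⟩ <;> rcases a with x | _ | x | ⟨x, _ | _ | _⟩ <;>
    simp only [CSATState.later, csatTrans, List.not_mem_nil, List.mem_singleton, Prod.mk.injEq,
      Bool.false_eq_true] at hq h
  case compare.true.digit.fresh =>
    split_ifs at h <;> simp only [List.not_mem_nil, List.mem_singleton, Prod.mk.injEq] at h <;>
      obtain ⟨rfl, rfl⟩ := h <;> simp [CSATState.later, CSATState.erased]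
  all_goals obtain ⟨rfl, rfl⟩ := h; simp [CSATState.later, CSATState.erased]

/-- A later pass that ends in a comparison has erased a letter. -/
theorem run_later {q q' : CSATState} {u v : List CSATLetter} (hq : q.later = true)
    (h : csatSweeper.Run q u v q') :
    q'.later = true ∧ (core v).length + q'.erased ≤ (core u).length + q.erased := by
  induction u generalizing q v with
  | nil =>
    obtain ⟨rfl, rfl⟩ := h
    exact ⟨hq, le_rfl⟩
  | cons a u ih =>
    obtain ⟨q₁, b, v₁, hb, hr, rfl⟩ := h
    obtain ⟨h1, h2⟩ := csatTrans_later hq hb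
    obtain ⟨h3, h4⟩ := ih h1 hr
    refine ⟨h3, ?_⟩
    rw [← List.singleton_append, core_append, ← List.singleton_append (l := u), core_append]
    simp only [List.length_append]
    omega

theorem csat_passes_le {x : List CNFSymbol} {k : ℕ} {u : List csatSweeper.Letter}
    {q : csatSweeper.State}
    (h : csatSweeper.Passes x k u q) :
    k = 0 ∧ q = .clause ∨ q = .find true ∧ (core u).length + k ≤ x.length + 1 := by
  induction h with
  | zero => exact .inl ⟨rfl, rfl⟩
  | @succ k u q v q₁ q₂ h hr hn ih =>
    obtain ⟨rfl, hn⟩ := hn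
    refine .inr ⟨rfl, ?_⟩
    rcases ih with ⟨rfl, rfl⟩ | ⟨rfl, ih⟩
    · have h1 : v.length = x.length := hr.length_eq.trans h.length_eq
      have h2 : (core v).length ≤ v.length := List.length_filter_le _ _
      omega
    · obtain ⟨h1, h2⟩ := run_later rfl hr
      rcases hn with rfl | ⟨s, a, t, b, rfl⟩
      · cases h1
      · simp only [CSATState.erased] at h2
        omega

/-! ### Erased letters are irrelevant -/

theorem exists_run_core {q q' : CSATState} {u v : List CSATLetter} (hq : q.later = true)
    (h : csatSweeper.Run q u v q') :
    ∃ v', csatSweeper.Run q (core u) v' q' ∧ core v' = core v := by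
  induction u generalizing q v with
  | nil => exact ⟨v, h, rfl⟩
  | cons a u ih =>
    obtain ⟨q₁, b, v₁, hb, hr, rfl⟩ := h
    obtain ⟨v', h1, h2⟩ := ih (csatTrans_later hq hb).1 hr
    by_cases ha : a = .skip
    · subst ha
      change (q₁, b) ∈ csatTrans q .skip at hb
      rw [csatTrans_skip hq, List.mem_singleton, Prod.mk.injEq] at hb
      obtain ⟨rfl, rfl⟩ := hb
      exact ⟨v', h1, h2⟩
    · refine ⟨b :: v', ?_, ?_⟩
      · have : core (a :: u) = a :: core u := by cases a <;> simp_all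
        rw [this]
        exact ⟨q₁, b, v', hb, h1, rfl⟩
      · cases b <;> simp [h2]

theorem exists_run_of_core {q q' : CSATState} {u v : List CSATLetter} (hq : q.later = true)
    (h : csatSweeper.Run q (core u) v q') :
    ∃ v', csatSweeper.Run q u v' q' ∧ core v' = core v := by
  induction u generalizing q v with
  | nil => exact ⟨v, h, rfl⟩
  | cons a u ih =>
    by_cases ha : a = .skip
    · subst ha
      obtain ⟨v', h1, h2⟩ := ih hq h
      refine ⟨.skip :: v', ⟨q, .skip, v', ?_, h1, rfl⟩, h2⟩
      change (q, CSATLetter.skip) ∈ csatTrans q .skip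
      rw [csatTrans_skip hq, List.mem_singleton]
    · have : core (a :: u) = a :: core u := by cases a <;> simp_all
      rw [this] at h
      obtain ⟨q₁, b, v₁, hb, hr, rfl⟩ := h
      obtain ⟨v', h1, h2⟩ := ih (csatTrans_later hq hb).1 hr
      refine ⟨b :: v', ⟨q₁, b, v', hb, h1, rfl⟩, ?_⟩
      cases b <;> simp [h2]

theorem accepts_of_core_eq {q : csatSweeper.State} {u u' : List csatSweeper.Letter}
    (hq : CSATState.later q = true)
    (hu : core u' = core u) (h : csatSweeper.Accepts q u) : csatSweeper.Accepts q u' := by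
  induction h generalizing u' with
  | done hr ha =>
    obtain ⟨v', h1, -⟩ := exists_run_core hq hr
    rw [← hu] at h1
    obtain ⟨v'', h2, -⟩ := exists_run_of_core hq h1
    exact .done h2 ha
  | pass hr hn h ih =>
    obtain ⟨v', h1, h1'⟩ := exists_run_core hq hr
    rw [← hu] at h1
    obtain ⟨v'', h2, h2'⟩ := exists_run_of_core hq h1
    exact .pass h2 hn (ih (by rw [hn.1]; rfl) (h2'.trans h1'))

theorem accepts_iff_of_core_eq {q : CSATState} {u u' : List CSATLetter} (hq : q.later = true)
    (hu : core u' = core u) : csatSweeper.Accepts q u' ↔ csatSweeper.Accepts q u :=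
  ⟨accepts_of_core_eq hq hu.symm, accepts_of_core_eq hq hu⟩

/-! ### The later passes: contradictory choices -/

/-- The written form of a chosen literal in the course of its comparison with the target: its sign,
the letters of its index that agree with the target, the first one that differs, if it has been
reached, and the remaining letters. -/
structure Block where
  sgn : Bool
  agree : List (Option Bool)
  differ : Option (Option Bool)
  rest : List (Option Bool)

namespace Block

/-- The index of the literal, with its end mark. -/
def word (b : Block) : List (Option Bool) := b.agree ++ b.differ.toList ++ b.rest

/-- The letters on the tape. -/
def render (b : Block) : List CSATLetter :=
  .sign b.sgn :: (b.agree.map (digit · .used) ++ b.differ.toList.map (digit · .off) ++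
    b.rest.map (digit · .fresh))

/-- A block without comparison marks. -/
def unmarked (s : Bool) (w : List (Option Bool)) : Block := ⟨s, [], none, w⟩

/-- The effect of a pass in which the letter `a` of the target is erased. -/
def advance (a : Option Bool) (b : Block) : Block :=
  if a = none then unmarked b.sgn b.word
  else match b with
    | ⟨s, l, none, c :: r⟩ => if c = a then ⟨s, l ++ [c], none, r⟩ else ⟨s, l, some c, r⟩
    | b => b

/-- The pass that erases the letter `a` of a target with sign `s` finds that the block has the same
index and the opposite sign. -/
def Clash (s : Bool) (a : Option Bool) (b : Block) : Prop :=
  a = none ∧ b.differ = none ∧ b.rest.head? = some none ∧ b.sgn ≠ s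

/-- After the pass over the block, the letter to be compared has still not been found. -/
def exhausted (b : Block) : Bool := b.differ.isNone && b.rest.isEmpty

end Block

/-- The runs of the sweeping device for CSAT. -/
def csatRun (q : CSATState) (u v : List CSATLetter) (q' : CSATState) : Prop :=
  csatSweeper.Run q u v q'

theorem csatRun_append {q q' : CSATState} {u₁ u₂ v : List CSATLetter} :
    csatRun q (u₁ ++ u₂) v q' ↔
      ∃ q₁ v₁ v₂, csatRun q u₁ v₁ q₁ ∧ csatRun q₁ u₂ v₂ q' ∧ v = v₁ ++ v₂ :=
  Sweeper.run_append

theorem run_cons_of_eq {q q₁ q' : CSATState} {a b : CSATLetter} {u v : List CSATLetter}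
    (h : csatTrans q a = [(q₁, b)]) :
    csatRun q (a :: u) v q' ↔ ∃ v₁, csatRun q₁ u v₁ q' ∧ v = b :: v₁ := by
  constructor
  · rintro ⟨q₂, b', v₁, hb, hr, rfl⟩
    change (q₂, b') ∈ csatTrans q a at hb
    rw [h, List.mem_singleton, Prod.mk.injEq] at hb
    obtain ⟨rfl, rfl⟩ := hb
    exact ⟨v₁, hr, rfl⟩
  · rintro ⟨v₁, hr, rfl⟩
    refine ⟨q₁, b, v₁, ?_, hr, rfl⟩
    change (q₁, b) ∈ csatTrans q a
    rw [h, List.mem_singleton]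

theorem run_nil {q q' : CSATState} {v : List CSATLetter} :
    csatRun q [] v q' ↔ v = [] ∧ q' = q := Iff.rfl

theorem run_find_signs {s₀ s : Bool} {ds : List Bool} {v : List CSATLetter} {q : CSATState} :
    csatRun (.find s₀) ((ds ++ [s]).map sign) v q ↔
      v = (ds ++ [s]).map sign ∧ q = .find s := by
  induction ds generalizing s₀ v with
  | nil =>
    rw [List.nil_append, List.map_singleton, run_cons_of_eq (q₁ := .find s) (b := .sign s) rfl]
    simp [run_nil, and_comm]
  | cons d ds ih =>
    rw [List.cons_append, List.map_cons, run_cons_of_eq (q₁ := .find d) (b := .sign d) rfl]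
    simp only [ih]
    constructor
    · rintro ⟨_, ⟨rfl, rfl⟩, rfl⟩
      exact ⟨rfl, rfl⟩
    · rintro ⟨rfl, rfl⟩
      exact ⟨_, ⟨rfl, rfl⟩, rfl⟩

theorem run_compare_used {s t k : Bool} {a : Option Bool} {l : List (Option Bool)}
    {v : List CSATLetter} {q : CSATState} :
    csatRun (.compare s a t k) (l.map (digit · .used)) v q ↔
      v = l.map (digit · (Mark.used.after a)) ∧ q = .compare s a t k := by
  induction l generalizing v with
  | nil => rfl
  | cons c l ih =>
    rw [List.map_cons, run_cons_of_eq (q₁ := .compare s a t k)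
      (b := .digit c (Mark.used.after a)) (by cases k <;> rfl)]
    simp only [ih]
    constructor
    · rintro ⟨_, ⟨rfl, rfl⟩, rfl⟩
      exact ⟨rfl, rfl⟩
    · rintro ⟨rfl, rfl⟩
      exact ⟨_, ⟨rfl, rfl⟩, rfl⟩

theorem run_compare_inactive {s t : Bool} {a : Option Bool} {l : List (Option Bool)}
    {v : List CSATLetter} {q : CSATState} :
    csatRun (.compare s a t false) (l.map (digit · .fresh)) v q ↔
      v = l.map (digit · .fresh) ∧ q = .compare s a t false := by
  induction l generalizing v with
  | nil => rfl
  | cons c l ih =>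
    rw [List.map_cons, run_cons_of_eq (q₁ := .compare s a t false) (b := .digit c .fresh)
      (by simp [csatTrans, Mark.after])]
    simp only [ih]
    constructor
    · rintro ⟨_, ⟨rfl, rfl⟩, rfl⟩
      exact ⟨rfl, rfl⟩
    · rintro ⟨rfl, rfl⟩
      exact ⟨_, ⟨rfl, rfl⟩, rfl⟩

theorem run_append_of_iff {q q₁ q' : CSATState} {u₁ u₂ v₁ v : List CSATLetter}
    (h : ∀ v q', csatRun q u₁ v q' ↔ v = v₁ ∧ q' = q₁) :
    csatRun q (u₁ ++ u₂) v q' ↔ ∃ v₂, csatRun q₁ u₂ v₂ q' ∧ v = v₁ ++ v₂ := by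
  rw [csatRun_append]
  constructor
  · rintro ⟨q₂, w, v₂, h1, h2, rfl⟩
    obtain ⟨rfl, rfl⟩ := (h _ _).mp h1
    exact ⟨v₂, h2, rfl⟩
  · rintro ⟨v₂, h2, rfl⟩
    exact ⟨q₁, v₁, v₂, (h _ _).mpr ⟨rfl, rfl⟩, h2, rfl⟩

theorem run_compare_block {s t k : Bool} {a : Option Bool} {b : Block}
    {v : List CSATLetter} {q : CSATState} :
    csatRun (.compare s a t k) b.render v q ↔
      ¬ b.Clash s a ∧ v = (b.advance a).render ∧ q = .compare s a b.sgn b.exhausted := by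
  obtain ⟨t', l, d, r⟩ := b
  have h0 : csatTrans (.compare s a t k) (.sign t') = [(.compare s a t' true, .sign t')] := by
    cases k <;> rfl
  rw [Block.render, run_cons_of_eq h0]
  simp only [List.append_assoc, run_append_of_iff fun _ _ => run_compare_used]
  rcases d with _ | d
  · rcases r with _ | ⟨c, r⟩
    · cases a <;> simp [run_nil, Block.Clash, Block.exhausted, Block.advance, Block.render,
        Block.unmarked, Block.word, Mark.after, and_comm]
    · by_cases hc : c = a
      · by_cases hcl : a = none ∧ t' ≠ s
        · have hnil : csatTrans (.compare s a t' true) (.digit c .fresh) = [] := by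
            simp [csatTrans, hc, hcl]
          constructor
          · rintro ⟨_, ⟨_, h, -⟩, -⟩
            obtain ⟨q₂, b, v₁, hb, -, -⟩ := h
            change (q₂, b) ∈ csatTrans _ _ at hb
            rw [hnil] at hb
            cases hb
          · rintro ⟨h, -⟩
            exact absurd ⟨hcl.1, rfl, by simp [hc, hcl.1], hcl.2⟩ h
        · have h1 : csatTrans (.compare s a t' true) (.digit c .fresh) =
              [(.compare s a t' false, .digit c (Mark.used.after a))] := by
            simp only [csatTrans, hc, if_true, if_neg hcl]
          have h2 : ¬ Block.Clash s a ⟨t', l, none, c :: r⟩ := fun h => hcl ⟨h.1, h.2.2.2⟩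
          simp only [Option.toList_none, List.map_nil, List.nil_append, List.map_cons,
            run_cons_of_eq h1, run_compare_inactive]
          subst hc
          cases c <;> simp [h2, Block.exhausted, Block.advance, Block.render,
            Block.unmarked, Block.word, Mark.after, and_comm]
      · have h1 : csatTrans (.compare s a t' true) (.digit c .fresh) =
            [(.compare s a t' false, .digit c (Mark.off.after a))] := by
          simp only [csatTrans, hc, if_false]
        have h2 : ¬ Block.Clash s a ⟨t', l, none, c :: r⟩ := by
          rintro ⟨rfl, -, h, -⟩
          simp at h
          exact hc h
        simp only [Option.toList_none, List.map_nil, List.nil_append, List.map_cons,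
          run_cons_of_eq h1, run_compare_inactive]
        cases a <;> simp [h2, hc, Block.exhausted, Block.advance, Block.render,
          Block.unmarked, Block.word, Mark.after, and_comm]
  · have h1 : csatTrans (.compare s a t' true) (.digit d .off) =
        [(.compare s a t' false, .digit d (Mark.off.after a))] := rfl
    simp only [Option.toList_some, List.map_cons, List.map_nil, List.cons_append, List.nil_append,
      run_cons_of_eq h1, run_compare_inactive]
    cases a <;> simp [Block.Clash, Block.exhausted, Block.advance, Block.render, Block.unmarked,
      Block.word, Mark.after, and_comm]

theorem run_compare_blocks {s t k : Bool} {a : Option Bool} {bs : List Block}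
    {v : List CSATLetter} {q : CSATState} :
    csatRun (.compare s a t k) (bs.flatMap Block.render) v q ↔
      (∀ b ∈ bs, ¬ b.Clash s a) ∧ v = (bs.map (Block.advance a)).flatMap Block.render ∧
        q = bs.foldl (fun _ b => .compare s a b.sgn b.exhausted) (.compare s a t k) := by
  induction bs generalizing t k v with
  | nil => simp [run_nil]
  | cons b bs ih =>
    simp only [List.flatMap_cons, csatRun_append, run_compare_block]
    constructor
    · rintro ⟨_, _, v₂, ⟨h1, rfl, rfl⟩, h2, rfl⟩
      obtain ⟨h3, rfl, rfl⟩ := ih.mp h2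
      exact ⟨by simpa using ⟨h1, h3⟩, by simp, by simp⟩
    · rintro ⟨h1, rfl, rfl⟩
      rw [List.forall_mem_cons] at h1
      exact ⟨_, _, _, ⟨h1.1, rfl, rfl⟩, ih.mpr ⟨h1.2, rfl, rfl⟩, by simp⟩

theorem exists_foldl_compare_eq (s t k : Bool) (a : Option Bool) (bs : List Block) :
    ∃ t' k', bs.foldl (fun _ b => CSATState.compare s a b.sgn b.exhausted) (.compare s a t k) =
      .compare s a t' k' := by
  induction bs generalizing t k with
  | nil => exact ⟨t, k, rfl⟩
  | cons b bs ih => exact ih _ _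

/-- The word in which `r` is left of the index of the target, whose sign `s` comes after the signs
`ds` of former targets. -/
def targetWord (ds : List Bool) (s : Bool) (r : List (Option Bool)) (bs : List Block) :
    List CSATLetter :=
  (ds ++ [s]).map sign ++ (r.map (digit · .fresh) ++ bs.flatMap Block.render)

theorem targetWord_nil_cons (ds : List Bool) (s t : Bool) (w : List (Option Bool))
    (bs : List Block) :
    targetWord ds s [] (.unmarked t w :: bs) = targetWord (ds ++ [s]) t w bs := by
  simp [targetWord, Block.unmarked, Block.render]

theorem accepts_targetWord_nil (ds : List Bool) (s : Bool) :
    csatSweeper.Accepts (.find true) (targetWord ds s [] []) := by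
  refine .done (q₁ := .find s) (v := targetWord ds s [] []) ?_ ⟨s, rfl⟩
  simp only [targetWord, List.map_nil, List.flatMap_nil, List.append_nil]
  exact run_find_signs.mpr ⟨rfl, rfl⟩

/-- One pass. -/
theorem accepts_targetWord_cons (ds : List Bool) (s : Bool) (a : Option Bool)
    (r : List (Option Bool)) (bs : List Block) :
    csatSweeper.Accepts (.find true) (targetWord ds s (a :: r) bs) ↔
      (∀ b ∈ bs, ¬ b.Clash s a) ∧
        csatSweeper.Accepts (.find true) (targetWord ds s r (bs.map (Block.advance a))) := by
  have h0 : csatTrans (.find s) (.digit a .fresh) = [(.compare s a s false, .skip)] := rfl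
  have key : ∀ v q, csatRun (.find true) (targetWord ds s (a :: r) bs) v q ↔
      (∀ b ∈ bs, ¬ b.Clash s a) ∧
        v = (ds ++ [s]).map sign ++ (.skip :: (r.map (digit · .fresh) ++
          (bs.map (Block.advance a)).flatMap Block.render)) ∧
        q = bs.foldl (fun _ b => .compare s a b.sgn b.exhausted) (.compare s a s false) := by
    intro v q
    simp only [targetWord, run_append_of_iff fun _ _ => run_find_signs, List.map_cons,
      List.cons_append, run_cons_of_eq h0, run_append_of_iff fun _ _ => run_compare_inactive,
      run_compare_blocks]
    constructor
    · rintro ⟨_, ⟨_, ⟨_, ⟨h, rfl, rfl⟩, rfl⟩, rfl⟩, rfl⟩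
      exact ⟨h, rfl, rfl⟩
    · rintro ⟨h, rfl, rfl⟩
      exact ⟨_, ⟨_, ⟨_, ⟨h, rfl, rfl⟩, rfl⟩, rfl⟩, rfl⟩
  obtain ⟨t', k', hq⟩ := exists_foldl_compare_eq s s false a bs
  have hcore : core (targetWord ds s r (bs.map (Block.advance a))) =
      core ((ds ++ [s]).map sign ++ (.skip :: (r.map (digit · .fresh) ++
          (bs.map (Block.advance a)).flatMap Block.render))) := by
    simp [targetWord]
  constructor
  · intro h
    obtain ⟨v, q₁, hr, ha | ⟨q₂, ⟨rfl, -⟩, h⟩⟩ := Sweeper.accepts_iff.mp h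
    · obtain ⟨-, -, rfl⟩ := (key _ _).mp hr
      obtain ⟨s', hs⟩ := ha
      rw [hq] at hs
      cases hs
    · obtain ⟨h1, rfl, -⟩ := (key _ _).mp hr
      exact ⟨h1, (accepts_iff_of_core_eq rfl hcore).mpr h⟩
  · rintro ⟨h1, h2⟩
    exact .pass ((key _ _).mpr ⟨h1, rfl, rfl⟩) ⟨rfl, .inr ⟨_, _, _, _, hq⟩⟩
      ((accepts_iff_of_core_eq rfl hcore).mp h2)

/-- A written index: some bits and the end mark. -/
def IsIndexWord (w : List (Option Bool)) : Prop := ∃ bs : List Bool, w = bs.map some ++ [none]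

theorem IsIndexWord.eq_of_suffix {w l r : List (Option Bool)} (h : IsIndexWord w)
    (hw : w = l ++ none :: r) : r = [] := by
  obtain ⟨bs, rfl⟩ := h
  induction bs generalizing l with
  | nil =>
    cases l with
    | nil => simpa using hw.symm
    | cons c l => simp at hw
  | cons b bs ih =>
    cases l with
    | nil => simp at hw
    | cons c l => exact ih (List.cons.inj hw).2

/-- The target and the blocks do not contain contradictory literals. -/
def NoContradiction (s : Bool) (r : List (Option Bool)) (bs : List Block) : Prop :=
  (∀ b ∈ bs, b.differ = none → b.rest = r → b.sgn = s) ∧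
    bs.Pairwise fun b b' => b.word = b'.word → b.sgn = b'.sgn

theorem Block.word_advance (a : Option Bool) (b : Block) : (b.advance a).word = b.word := by
  obtain ⟨s, l, _ | d, _ | ⟨c, r⟩⟩ := b <;> simp only [advance] <;> split_ifs <;>
    simp [word, unmarked]

theorem Block.sgn_advance (a : Option Bool) (b : Block) : (b.advance a).sgn = b.sgn := by
  obtain ⟨s, l, _ | d, _ | ⟨c, r⟩⟩ := b <;> simp only [advance] <;> split_ifs <;>
    simp [unmarked]

theorem Block.advance_rest_iff (a : Bool) {r : List (Option Bool)} (hr : r ≠ []) (b : Block) :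
    ((b.advance (some a)).differ = none ∧ (b.advance (some a)).rest = r) ↔
      (b.differ = none ∧ b.rest = some a :: r) := by
  obtain ⟨s, l, _ | d, _ | ⟨c, r'⟩⟩ := b <;> simp only [advance, reduceCtorEq, if_false] <;>
    (try split_ifs) <;> simp_all [eq_comm]

theorem accepts_targetWord_iff (n : ℕ) (ds : List Bool) (s : Bool) (r : List (Option Bool))
    (bs : List Block) (hn : r.length + (bs.map (·.word.length)).sum = n) (hr : IsIndexWord r)
    (hbs : ∀ b ∈ bs, IsIndexWord b.word) :
    csatSweeper.Accepts (.find true) (targetWord ds s r bs) ↔ NoContradiction s r bs := by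
  induction n using Nat.strong_induction_on generalizing ds s r bs with
  | _ n ih =>
    obtain ⟨bits, rfl⟩ := hr
    rcases bits with _ | ⟨c, bits⟩
    · -- The target ends in this pass: all marks are removed; the first block is the next target.
      rw [List.map_nil, List.nil_append, accepts_targetWord_cons]
      have hadv : ∀ b : Block, b.advance none = .unmarked b.sgn b.word := fun b => by
        simp [Block.advance]
      have hclash : (∀ b ∈ bs, ¬ b.Clash s none) ↔
          ∀ b ∈ bs, b.differ = none → b.rest = [none] → b.sgn = s := by
        refine forall₂_congr fun b hb => ?_
        constructor
        · intro h h1 h2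
          by_contra h3
          exact h ⟨rfl, h1, by simp [h2], h3⟩
        · rintro h ⟨-, h1, h2, h3⟩
          obtain ⟨r', hr'⟩ : ∃ r', b.rest = none :: r' := by
            cases hb' : b.rest with
            | nil => simp [hb'] at h2
            | cons x r' =>
              obtain rfl : x = none := by simpa [hb'] using h2
              exact ⟨r', rfl⟩
          have := (hbs b hb).eq_of_suffix (l := b.agree) (r := r') (by simp [Block.word, h1, hr'])
          exact h3 (h h1 (by rw [hr', this]))
      rw [hclash, NoContradiction]
      refine and_congr_right fun _ => ?_
      cases bs with
      | nil => simp [accepts_targetWord_nil]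
      | cons b bs =>
        simp only [List.map_cons, List.sum_cons, List.map_nil, List.length_append,
          List.length_singleton, List.length_nil] at hn
        rw [List.map_cons, hadv, targetWord_nil_cons, ih (n - 1) (by omega) _ _ _ _ _
          (hbs b (by simp)) _, NoContradiction, List.pairwise_cons, List.pairwise_map]
        · simp only [List.forall_mem_map, hadv]
          refine and_congr_left fun _ => forall₂_congr fun b' _ => ?_
          simp only [Block.unmarked, forall_const]
          exact ⟨fun h h' => (h h'.symm).symm, fun h h' => (h h'.symm).symm⟩
        · simp only [List.map_map, Function.comp_def, Block.word_advance]
          omega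
        · simp only [List.forall_mem_map, Block.word_advance]
          exact fun b' hb' => hbs b' (by simp [hb'])
    · rw [List.map_cons, List.cons_append, accepts_targetWord_cons, ih (n - 1) _ _ _ _ _ _
        ⟨bits, rfl⟩]
      · have hclash : ∀ b ∈ bs, ¬ b.Clash s (some c) := fun b _ h => by cases h.1
        rw [and_iff_right hclash]
        simp only [NoContradiction, List.forall_mem_map, List.pairwise_map, Block.word_advance,
          Block.sgn_advance]
        refine and_congr_left fun _ => forall₂_congr fun b _ => ?_
        rw [← and_imp, ← and_imp, Block.advance_rest_iff c (by simp)]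
      · simp only [List.forall_mem_map, Block.word_advance]
        exact hbs
      · simp only [List.map_cons, List.cons_append, List.length_cons] at hn
        omega
      · simp only [List.map_cons, List.cons_append, List.length_cons] at hn
        simp only [List.map_map, Function.comp_def, Block.word_advance]
        omega

/-- The later passes accept if and only if the chosen literals are not contradictory. -/
theorem accepts_render_iff (bs : List Block)
    (hbs : ∀ b ∈ bs, IsIndexWord b.word ∧ b = .unmarked b.sgn b.word) :
    csatSweeper.Accepts (.find true) (bs.flatMap Block.render) ↔
      bs.Pairwise fun b b' => b.word = b'.word → b.sgn = b'.sgn := by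
  cases bs with
  | nil =>
    simp only [List.flatMap_nil, List.Pairwise.nil, iff_true]
    exact .done (q₁ := .find true) (v := []) ⟨rfl, rfl⟩ ⟨true, rfl⟩
  | cons b bs =>
    have h1 : (b :: bs).flatMap Block.render = targetWord [] b.sgn b.word bs := by
      rw [List.flatMap_cons, (hbs b (by simp)).2]
      simp [targetWord, Block.render, Block.unmarked, Block.word]
    rw [h1, accepts_targetWord_iff _ _ _ _ _ rfl (hbs b (by simp)).1
      fun b' hb' => (hbs b' (by simp [hb'])).1, NoContradiction, List.pairwise_cons]
    refine and_congr_left fun _ => forall₂_congr fun b' hb' => ?_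
    have h2 := (hbs b' (by simp [hb'])).2
    have h3 : b'.differ = none := by rw [h2]; rfl
    have h4 : b'.rest = b'.word := by
      conv_lhs => rw [h2]
      rfl
    simp only [h3, h4, forall_const]
    exact ⟨fun h h' => (h h'.symm).symm, fun h h' => (h h'.symm).symm⟩

/-! ### The first pass: choosing a literal in each clause -/

namespace CNFLiteral

/-- The sign of a literal: `true` if the variable is not negated. -/
def sgn : CNFLiteral → Bool
  | .pos _ => true
  | .neg _ => false

/-- The index of the variable of a literal. -/
def idx : CNFLiteral → ℕ
  | .pos i => i
  | .neg i => i

theorem holds_iff (v : ℕ → Bool) (l : CNFLiteral) : l.Holds v ↔ v l.idx = l.sgn := by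
  cases l <;> rfl

/-- The literal with a given sign and index. -/
def ofSign (s : Bool) (i : ℕ) : CNFLiteral := if s then .pos i else .neg i

@[simp] theorem sgn_ofSign (s : Bool) (i : ℕ) : (ofSign s i).sgn = s := by cases s <;> rfl

@[simp] theorem idx_ofSign (s : Bool) (i : ℕ) : (ofSign s i).idx = i := by cases s <;> rfl

/-- A chosen literal, as it is written by the first pass. -/
def block (l : CNFLiteral) : Block := .unmarked l.sgn (l.idx.bits.map some ++ [none])

end CNFLiteral

namespace CNFSymbol

/-- The symbol that introduces a literal with a given sign. -/
def ofSign (s : Bool) : CNFSymbol := if s then .pos else .neg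

theorem eq_ofSign_or (a : CNFSymbol) :
    (∃ s, a = ofSign s) ∨ (∃ b, a = .bit b) ∨ a = .close := by
  cases a with
  | pos => exact .inl ⟨true, rfl⟩
  | neg => exact .inl ⟨false, rfl⟩
  | bit b => exact .inr (.inl ⟨b, rfl⟩)
  | close => exact .inr (.inr rfl)

end CNFSymbol

theorem CNFLiteral.encode_eq (l : CNFLiteral) :
    l.encode = .ofSign l.sgn :: l.idx.bits.map .bit := by
  cases l <;> rfl

theorem CNFLiteral.encode_ofSign (s : Bool) (i : ℕ) :
    (ofSign s i).encode = .ofSign s :: i.bits.map .bit := by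
  cases s <;> rfl

/-- The bits may complete an index whose last bit so far was `0` if and only if `zero` holds: the
most significant bit of an index is `1`. -/
def CanComplete : Bool → List Bool → Prop
  | zero, [] => zero = false
  | _, b :: bs => CanComplete (!b) bs

theorem CanComplete.exists_bits_eq {zero : Bool} {bs : List Bool} (h : CanComplete zero bs) :
    ∃ i : ℕ, i.bits = bs ∧ (zero = true → i ≠ 0) := by
  induction bs generalizing zero with
  | nil =>
    have h : zero = false := h
    exact ⟨0, by simp, by simp [h]⟩
  | cons b bs ih =>
    obtain ⟨i, rfl, hi⟩ := ih h
    have hb : i = 0 → b = true := by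
      intro h0
      cases b
      · exact absurd h0 (hi rfl)
      · rfl
    refine ⟨Nat.bit b i, Nat.bits_append_bit i b hb, fun _ => ?_⟩
    rw [Ne, Nat.bit_eq_zero_iff]
    rintro ⟨h0, rfl⟩
    cases hb h0

theorem canComplete_bits (i : ℕ) (zero : Bool) (h : zero = true → i ≠ 0) :
    CanComplete zero i.bits := by
  induction i using Nat.binaryRec' generalizing zero with
  | zero =>
    cases zero
    · simp [CanComplete]
    · exact absurd rfl (h rfl)
  | bit b n hn ih =>
    rw [Nat.bits_append_bit n b hn]
    refine ih (!b) fun hb h0 => ?_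
    rw [hn h0] at hb
    cases hb

theorem bits_injective {i j : ℕ} (h : i.bits = j.bits) : i = j := by
  induction i using Nat.binaryRec' generalizing j with
  | zero =>
    induction j using Nat.binaryRec' with
    | zero => rfl
    | bit b n hn _ => simp [Nat.bits_append_bit n b hn] at h
  | bit b n hn ih =>
    induction j using Nat.binaryRec' with
    | zero => simp [Nat.bits_append_bit n b hn] at h
    | bit b' n' hn' _ =>
      rw [Nat.bits_append_bit n b hn, Nat.bits_append_bit n' b' hn', List.cons.injEq] at h
      rw [h.1, ih h.2]

theorem csatTrans_clause_sign (s : Bool) :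
    csatTrans .clause (.raw (.ofSign s)) =
      [(.literal .pending false, .skip), (.literal .current false, .sign s)] := by
  cases s <;> rfl

theorem csatTrans_pending_sign (s : Bool) :
    csatTrans (.literal .pending false) (.raw (.ofSign s)) =
      [(.literal .pending false, .skip), (.literal .current false, .sign s)] := by
  cases s <;> rfl

theorem csatTrans_current_sign (s : Bool) :
    csatTrans (.literal .current false) (.raw (.ofSign s)) =
      [(.literal .settled false, .digit none .fresh)] := by
  cases s <;> rfl

theorem csatTrans_settled_sign (s : Bool) :
    csatTrans (.literal .settled false) (.raw (.ofSign s)) =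
      [(.literal .settled false, .skip)] := by
  cases s <;> rfl

theorem csatTrans_zero_sign (sel : Choice) (s : Bool) :
    csatTrans (.literal sel true) (.raw (.ofSign s)) = [] := by
  cases s <;> cases sel <;> rfl

theorem csatRun_cons {q q' : CSATState} {a : CSATLetter} {u v : List CSATLetter} :
    csatRun q (a :: u) v q' ↔
      ∃ q₁ b v₁, (q₁, b) ∈ csatTrans q a ∧ csatRun q₁ u v₁ q' ∧ v = b :: v₁ := Iff.rfl

/-- The literals `sel` are chosen in the clauses of `φ`. -/
abbrev IsChoice (sel : List CNFLiteral) (φ : CNFFormula) : Prop := List.Forall₂ (· ∈ ·) sel φ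

/-- The written form of chosen literals. -/
def writeChoice (sel : List CNFLiteral) : List CSATLetter :=
  (sel.map CNFLiteral.block).flatMap Block.render

theorem writeChoice_cons (l : CNFLiteral) (sel : List CNFLiteral) :
    writeChoice (l :: sel) = .sign l.sgn ::
      (l.idx.bits.map some ++ [none]).map (digit · .fresh) ++ writeChoice sel := by
  simp [writeChoice, CNFLiteral.block, Block.unmarked, Block.render]

theorem encode_formula_cons (C : CNFClause) (φ : CNFFormula) :
    CNFFormula.encode (C :: φ) = CNFClause.encode C ++ CNFFormula.encode φ := rfl

theorem encode_clause_cons (l : CNFLiteral) (C : CNFClause) :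
    CNFClause.encode (l :: C) = l.encode ++ CNFClause.encode C := by
  simp [CNFClause.encode]

/-- A word on which the first pass succeeds is the code of a formula, and the pass writes chosen
literals.  The other three statements are about the rest of such a word, read from inside a
literal. -/
theorem exists_choice_of_csatRun (x : List CNFSymbol) : ∀ v : List CSATLetter,
    (csatRun .clause (x.map raw) v .clause →
      ∃ φ sel, IsChoice sel φ ∧ x = CNFFormula.encode φ ∧ core v = writeChoice sel) ∧
    (∀ z, csatRun (.literal .pending z) (x.map raw) v .clause →
      ∃ bs C φ l sel, CanComplete z bs ∧ l ∈ C ∧ IsChoice sel φ ∧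
        x = bs.map .bit ++ (CNFClause.encode C ++ CNFFormula.encode φ) ∧
        core v = writeChoice (l :: sel)) ∧
    (∀ z, csatRun (.literal .current z) (x.map raw) v .clause →
      ∃ bs C φ sel, CanComplete z bs ∧ IsChoice sel φ ∧
        x = bs.map .bit ++ (CNFClause.encode C ++ CNFFormula.encode φ) ∧
        core v = (bs.map some ++ [none]).map (digit · .fresh) ++ writeChoice sel) ∧
    (∀ z, csatRun (.literal .settled z) (x.map raw) v .clause →
      ∃ bs C φ sel, CanComplete z bs ∧ IsChoice sel φ ∧
        x = bs.map .bit ++ (CNFClause.encode C ++ CNFFormula.encode φ) ∧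
        core v = writeChoice sel) := by
  induction x with
  | nil =>
    intro v
    refine ⟨fun h => ⟨[], [], .nil, rfl, by rw [h.1]; rfl⟩, fun z h => ?_, fun z h => ?_,
      fun z h => ?_⟩ <;> cases h.2
  | cons a x ih =>
    intro v
    simp only [List.map_cons, csatRun_cons]
    rcases a.eq_ofSign_or with ⟨s, rfl⟩ | ⟨b, rfl⟩ | rfl
    · refine ⟨?_, ?_, ?_, ?_⟩
      · rintro ⟨q₁, b, v₁, hb, hr, rfl⟩
        rw [csatTrans_clause_sign, List.mem_pair] at hb
        rcases hb with hb | hb <;> cases hb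
        · obtain ⟨bs, C, φ, l, sel, h1, h2, h3, rfl, h4⟩ := (ih v₁).2.1 false hr
          obtain ⟨i, rfl, -⟩ := h1.exists_bits_eq
          exact ⟨(.ofSign s i :: C) :: φ, l :: sel, .cons (by simp [h2]) h3,
            by simp [encode_formula_cons, encode_clause_cons, CNFLiteral.encode_ofSign], h4⟩
        · obtain ⟨bs, C, φ, sel, h1, h3, rfl, h4⟩ := (ih v₁).2.2.1 false hr
          obtain ⟨i, rfl, -⟩ := h1.exists_bits_eq
          exact ⟨(.ofSign s i :: C) :: φ, .ofSign s i :: sel, .cons (by simp) h3,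
            by simp [encode_formula_cons, encode_clause_cons, CNFLiteral.encode_ofSign],
            by simp [h4, writeChoice_cons]⟩
      · rintro (_ | _) ⟨q₁, b, v₁, hb, hr, rfl⟩
        · rw [csatTrans_pending_sign, List.mem_pair] at hb
          rcases hb with hb | hb <;> cases hb
          · obtain ⟨bs, C, φ, l, sel, h1, h2, h3, rfl, h4⟩ := (ih v₁).2.1 false hr
            obtain ⟨i, rfl, -⟩ := h1.exists_bits_eq
            exact ⟨[], .ofSign s i :: C, φ, l, sel, rfl, by simp [h2], h3,
              by simp [encode_clause_cons, CNFLiteral.encode_ofSign], h4⟩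
          · obtain ⟨bs, C, φ, sel, h1, h3, rfl, h4⟩ := (ih v₁).2.2.1 false hr
            obtain ⟨i, rfl, -⟩ := h1.exists_bits_eq
            exact ⟨[], .ofSign s i :: C, φ, .ofSign s i, sel, rfl, by simp, h3,
              by simp [encode_clause_cons, CNFLiteral.encode_ofSign],
              by simp [h4, writeChoice_cons]⟩
        · rw [csatTrans_zero_sign] at hb
          cases hb
      · rintro (_ | _) ⟨q₁, b, v₁, hb, hr, rfl⟩
        · rw [csatTrans_current_sign, List.mem_singleton] at hb
          cases hb
          obtain ⟨bs, C, φ, sel, h1, h3, rfl, h4⟩ := (ih v₁).2.2.2 false hr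
          obtain ⟨i, rfl, -⟩ := h1.exists_bits_eq
          exact ⟨[], .ofSign s i :: C, φ, sel, rfl, h3,
            by simp [encode_clause_cons, CNFLiteral.encode_ofSign], by simp [h4]⟩
        · rw [csatTrans_zero_sign] at hb
          cases hb
      · rintro (_ | _) ⟨q₁, b, v₁, hb, hr, rfl⟩
        · rw [csatTrans_settled_sign, List.mem_singleton] at hb
          cases hb
          obtain ⟨bs, C, φ, sel, h1, h3, rfl, h4⟩ := (ih v₁).2.2.2 false hr
          obtain ⟨i, rfl, -⟩ := h1.exists_bits_eq
          exact ⟨[], .ofSign s i :: C, φ, sel, rfl, h3,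
            by simp [encode_clause_cons, CNFLiteral.encode_ofSign], by simp [h4]⟩
        · rw [csatTrans_zero_sign] at hb
          cases hb
    · refine ⟨?_, ?_, ?_, ?_⟩
      · rintro ⟨q₁, b', v₁, hb, hr, rfl⟩
        cases hb
      · rintro z ⟨q₁, b', v₁, hb, hr, rfl⟩
        rw [csatTrans, List.mem_singleton] at hb
        · cases hb
          obtain ⟨bs, C, φ, l, sel, h1, h2, h3, rfl, h4⟩ := (ih v₁).2.1 (!b) hr
          exact ⟨b :: bs, C, φ, l, sel, h1, h2, h3, by simp, h4⟩
        · simp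
      · rintro z ⟨q₁, b', v₁, hb, hr, rfl⟩
        rw [csatTrans, List.mem_singleton] at hb
        cases hb
        obtain ⟨bs, C, φ, sel, h1, h3, rfl, h4⟩ := (ih v₁).2.2.1 (!b) hr
        exact ⟨b :: bs, C, φ, sel, h1, h3, by simp, by simp [h4]⟩
      · rintro z ⟨q₁, b', v₁, hb, hr, rfl⟩
        rw [csatTrans, List.mem_singleton] at hb
        · cases hb
          obtain ⟨bs, C, φ, sel, h1, h3, rfl, h4⟩ := (ih v₁).2.2.2 (!b) hr
          exact ⟨b :: bs, C, φ, sel, h1, h3, by simp, h4⟩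
        · simp
    · refine ⟨?_, ?_, ?_, ?_⟩
      · rintro ⟨q₁, b', v₁, hb, hr, rfl⟩
        cases hb
      · rintro (_ | _) ⟨q₁, b', v₁, hb, hr, rfl⟩ <;> cases hb
      · rintro (_ | _) ⟨q₁, b', v₁, hb, hr, rfl⟩
        · rw [show csatTrans (.literal .current false) (.raw .close) =
            [(.clause, .digit none .fresh)] from rfl, List.mem_singleton] at hb
          cases hb
          obtain ⟨φ, sel, h1, rfl, h2⟩ := (ih v₁).1 hr
          exact ⟨[], [], φ, sel, rfl, h1, by simp [CNFClause.encode], by simp [h2]⟩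
        · cases hb
      · rintro (_ | _) ⟨q₁, b', v₁, hb, hr, rfl⟩
        · rw [show csatTrans (.literal .settled false) (.raw .close) =
            [(.clause, .skip)] from rfl, List.mem_singleton] at hb
          cases hb
          obtain ⟨φ, sel, h1, rfl, h2⟩ := (ih v₁).1 hr
          exact ⟨[], [], φ, sel, rfl, h1, by simp [CNFClause.encode], by simp [h2]⟩
        · cases hb

/-- The letters that the first pass writes in place of the bits of an index. -/
def chosenDigits : Choice → List Bool → List CSATLetter
  | .current, bs => (bs.map some).map (digit · .fresh)
  | _, _ => []

/-- The first pass over the bits of an index. -/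
theorem exists_csatRun_bits (sel : Choice) {z : Bool} {bs : List Bool} (h : CanComplete z bs) :
    ∃ v, csatRun (.literal sel z) ((bs.map .bit).map raw) v (.literal sel false) ∧
      core v = chosenDigits sel bs := by
  induction bs generalizing z with
  | nil =>
    have h : z = false := h
    subst h
    exact ⟨[], ⟨rfl, rfl⟩, by cases sel <;> rfl⟩
  | cons b bs ih =>
    obtain ⟨v, h1, h2⟩ := ih h
    cases sel with
    | current =>
      exact ⟨.digit (some b) .fresh :: v, csatRun_cons.mpr ⟨_, _, _, by simp [csatTrans], h1, rfl⟩,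
        by simpa [chosenDigits] using h2⟩
    | _ =>
      exact ⟨.skip :: v, csatRun_cons.mpr ⟨_, _, _, by simp [csatTrans], h1, rfl⟩, h2⟩

/-- The first pass over a literal. -/
theorem exists_csatRun_literal (sel : Choice) {q : CSATState} {b : CSATLetter} (l : CNFLiteral)
    (h : (CSATState.literal sel false, b) ∈ csatTrans q (.raw (.ofSign l.sgn))) :
    ∃ v, csatRun q (l.encode.map raw) (b :: v) (.literal sel false) ∧
      core v = chosenDigits sel l.idx.bits := by
  obtain ⟨v, h1, h2⟩ := exists_csatRun_bits sel (canComplete_bits l.idx false (by simp))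
  exact ⟨v, by rw [l.encode_eq]; exact csatRun_cons.mpr ⟨_, _, _, h, h1, rfl⟩, h2⟩

theorem exists_csatRun_settled (C : CNFClause) :
    ∃ v, csatRun (.literal .settled false) ((CNFClause.encode C).map raw) v .clause ∧
      core v = [] := by
  induction C with
  | nil => exact ⟨[.skip], csatRun_cons.mpr ⟨_, _, _, by simp [csatTrans, csatChoose], ⟨rfl, rfl⟩,
      rfl⟩, rfl⟩
  | cons l C ih =>
    obtain ⟨v₁, h1, h2⟩ := exists_csatRun_literal .settled (q := .literal .settled false)
      (b := .skip) l (by simp [csatTrans_settled_sign])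
    obtain ⟨v₂, h3, h4⟩ := ih
    refine ⟨(.skip :: v₁) ++ v₂, ?_, by simp [h2, h4, chosenDigits]⟩
    rw [encode_clause_cons, List.map_append]
    exact csatRun_append.mpr ⟨_, _, _, h1, h3, rfl⟩

theorem exists_csatRun_current (C : CNFClause) :
    ∃ v, csatRun (.literal .current false) ((CNFClause.encode C).map raw) v .clause ∧
      core v = [.digit none .fresh] := by
  cases C with
  | nil => exact ⟨[.digit none .fresh], csatRun_cons.mpr ⟨_, _, _,
      by simp [csatTrans, csatChoose], ⟨rfl, rfl⟩, rfl⟩, rfl⟩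
  | cons l C =>
    obtain ⟨v₁, h1, h2⟩ := exists_csatRun_literal .settled (q := .literal .current false)
      (b := .digit none .fresh) l (by simp [csatTrans_current_sign])
    obtain ⟨v₂, h3, h4⟩ := exists_csatRun_settled C
    refine ⟨(.digit none .fresh :: v₁) ++ v₂, ?_, by simp [h2, h4, chosenDigits]⟩
    rw [encode_clause_cons, List.map_append]
    exact csatRun_append.mpr ⟨_, _, _, h1, h3, rfl⟩

/-- The first pass may choose any literal of a clause. -/
theorem exists_csatRun_clause {l : CNFLiteral} {C : CNFClause} (h : l ∈ C) (q : CSATState)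
    (hq : q = .clause ∨ q = .literal .pending false) :
    ∃ v, csatRun q ((CNFClause.encode C).map raw) v .clause ∧ core v = writeChoice [l] := by
  induction C generalizing q with
  | nil => cases h
  | cons l' C ih =>
    have htrans : csatTrans q (.raw (.ofSign l'.sgn)) =
        [(.literal .pending false, .skip), (.literal .current false, .sign l'.sgn)] := by
      rcases hq with rfl | rfl
      exacts [csatTrans_clause_sign _, csatTrans_pending_sign _]
    rw [encode_clause_cons, List.map_append]
    rcases List.mem_cons.mp h with rfl | h
    · obtain ⟨v₁, h1, h2⟩ := exists_csatRun_literal .current (q := q) (b := .sign l.sgn) l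
        (by simp [htrans])
      obtain ⟨v₂, h3, h4⟩ := exists_csatRun_current C
      refine ⟨(.sign l.sgn :: v₁) ++ v₂, csatRun_append.mpr ⟨_, _, _, h1, h3, rfl⟩, ?_⟩
      rw [writeChoice_cons]
      simp [h2, h4, chosenDigits, writeChoice]
    · obtain ⟨v₁, h1, h2⟩ := exists_csatRun_literal .pending (q := q) (b := .skip) l'
        (by simp [htrans])
      obtain ⟨v₂, h3, h4⟩ := ih h (.literal .pending false) (.inr rfl)
      exact ⟨(.skip :: v₁) ++ v₂, csatRun_append.mpr ⟨_, _, _, h1, h3, rfl⟩,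
        by simp [h2, h4, chosenDigits]⟩

theorem exists_csatRun_of_isChoice {sel : List CNFLiteral} {φ : CNFFormula}
    (h : IsChoice sel φ) :
    ∃ v, csatRun .clause ((CNFFormula.encode φ).map raw) v .clause ∧
      core v = writeChoice sel := by
  induction h with
  | nil => exact ⟨[], ⟨rfl, rfl⟩, rfl⟩
  | @cons l C sel φ hl h ih =>
    obtain ⟨v₁, h1, h2⟩ := exists_csatRun_clause hl .clause (.inl rfl)
    obtain ⟨v₂, h3, h4⟩ := ih
    refine ⟨v₁ ++ v₂, ?_, by simp [h2, h4, writeChoice]⟩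
    rw [encode_formula_cons, List.map_append]
    exact csatRun_append.mpr ⟨_, _, _, h1, h3, rfl⟩

/-! ### CSAT is in NP -/

/-- A formula is satisfiable if and only if one can choose literals, one in each clause, that do
not contradict each other. -/
theorem isSat_iff_exists_choice (φ : CNFFormula) :
    φ.IsSat ↔ ∃ sel, IsChoice sel φ ∧
      sel.Pairwise fun l l' => l.idx = l'.idx → l.sgn = l'.sgn := by
  constructor
  · rintro ⟨v, hv⟩
    suffices ∃ sel, IsChoice sel φ ∧ ∀ l ∈ sel, l.Holds v by
      obtain ⟨sel, h1, h2⟩ := this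
      refine ⟨sel, h1, List.pairwise_of_forall_mem_list fun l hl l' hl' h => ?_⟩
      rw [← (l.holds_iff v).mp (h2 l hl), ← (l'.holds_iff v).mp (h2 l' hl'), h]
    induction φ with
    | nil => exact ⟨[], .nil, by simp⟩
    | cons C φ ih =>
      rw [List.forall_mem_cons] at hv
      obtain ⟨sel, h1, h2⟩ := ih hv.2
      obtain ⟨l, hl, hl'⟩ := hv.1
      exact ⟨l :: sel, .cons hl h1, by simpa using ⟨hl', h2⟩⟩
  · rintro ⟨sel, h1, h2⟩
    classical
    have h3 : ∀ l ∈ sel, ∀ l' ∈ sel, l.idx = l'.idx → l.sgn = l'.sgn := by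
      intro l hl l' hl'
      refine List.Pairwise.forall_of_forall_of_flip (fun _ _ _ => rfl) h2 ?_ hl hl'
      exact h2.imp fun h h' => (h h'.symm).symm
    refine ⟨fun i => decide (∃ l ∈ sel, l.idx = i ∧ l.sgn = true), ?_⟩
    have h4 : ∀ l ∈ sel, l.Holds fun i => decide (∃ l ∈ sel, l.idx = i ∧ l.sgn = true) := by
      intro l hl
      rw [CNFLiteral.holds_iff, Bool.eq_iff_iff, decide_eq_true_eq]
      exact ⟨fun ⟨l', hl', h, hs⟩ => (h3 l' hl' l hl h) ▸ hs, fun hs => ⟨l, hl, rfl, hs⟩⟩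
    clear h2 h3
    intro C hC
    generalize (fun i => decide (∃ l ∈ sel, l.idx = i ∧ l.sgn = true)) = v at h4
    induction h1 with
    | nil => cases hC
    | @cons l C' sel φ hl h ih =>
      rw [List.forall_mem_cons] at h4
      rcases List.mem_cons.mp hC with rfl | hC
      · exact ⟨l, hl, h4.1⟩
      · exact ih hC h4.2

theorem csatTrans_first {q q' : CSATState} {a b : CSATLetter} (hq : q.later = false)
    (h : (q', b) ∈ csatTrans q a) : q'.later = false := by
  rcases q with _ | ⟨_ | _ | _, _ | _⟩ | _ | _ <;> rcases a with (_ | _ | _ | _) | _ | _ | _ <;>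
    simp [CSATState.later, csatTrans, csatChoose] at hq h <;>
    (rcases h with ⟨rfl, -⟩ | ⟨rfl, -⟩ <;> rfl)

theorem run_first {q q' : CSATState} {u v : List CSATLetter} (hq : q.later = false)
    (h : csatRun q u v q') : q'.later = false := by
  induction u generalizing q v with
  | nil =>
    obtain ⟨rfl, rfl⟩ := h
    exact hq
  | cons a u ih =>
    obtain ⟨q₁, b, v₁, hb, hr, rfl⟩ := h
    exact ih (csatTrans_first hq hb) hr

theorem accepts_of_core_eq_writeChoice {sel : List CNFLiteral} {v : List CSATLetter}
    (h : core v = writeChoice sel) :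
    csatSweeper.Accepts (.find true) v ↔
      sel.Pairwise fun l l' => l.idx = l'.idx → l.sgn = l'.sgn := by
  have h1 : core v = core (writeChoice sel) := by rw [← h, core_core]
  rw [accepts_iff_of_core_eq rfl h1, writeChoice, accepts_render_iff, List.pairwise_map]
  · have h2 : ∀ l l' : CNFLiteral, l.block.word = l'.block.word ↔ l.idx = l'.idx := by
      intro l l'
      simp only [CNFLiteral.block, Block.word, Block.unmarked, List.nil_append,
        Option.toList_none, List.append_left_inj]
      constructor
      · exact fun h => bits_injective ((List.map_injective_iff.mpr (Option.some_injective _)) h)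
      · exact fun h => by rw [h]
    simp only [h2]
    rfl
  · simp only [List.forall_mem_map]
    exact fun l _ => ⟨⟨l.idx.bits, rfl⟩, rfl⟩

theorem language_csatSweeper : csatSweeper.language = CSAT := by
  ext x
  constructor
  · intro h
    obtain ⟨v, q, hr, ⟨s, rfl⟩ | ⟨q₂, ⟨rfl, hn⟩, ha⟩⟩ := Sweeper.accepts_iff.mp h
    · cases run_first rfl hr
    · rcases hn with rfl | ⟨s, a, t, k, rfl⟩
      · obtain ⟨φ, sel, h1, rfl, h2⟩ := (exists_choice_of_csatRun x v).1 hr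
        exact ⟨φ, (isSat_iff_exists_choice φ).mpr
          ⟨sel, h1, (accepts_of_core_eq_writeChoice h2).mp ha⟩, rfl⟩
      · cases run_first rfl hr
  · rintro ⟨φ, hφ, rfl⟩
    obtain ⟨sel, h1, h2⟩ := (isSat_iff_exists_choice φ).mp hφ
    obtain ⟨v, h3, h4⟩ := exists_csatRun_of_isChoice h1
    exact .pass h3 ⟨rfl, .inl rfl⟩ ((accepts_of_core_eq_writeChoice h4).mpr h2)

theorem csat_mem_classNP : CSAT ∈ ClassNP CNFSymbol := by
  refine ⟨csatSweeper.machine,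
    (Polynomial.X + 1) * (3 * Polynomial.X + 2) + (3 * Polynomial.X + 1),
    csatSweeper.isNDTM_machine, ?_⟩
  have h := csatSweeper.ndDecidesInTime_machine (fun n => n + 1) fun x k u q h => by
    rcases csat_passes_le h with ⟨rfl, -⟩ | ⟨-, h⟩ <;> omega
  rw [language_csatSweeper] at h
  simpa using h

/-! ### Languages in NP -/

theorem eParTMPolyTime_of_mem_classNP {A : Type} {L : Language A} (h : L ∈ ClassNP A) :
    EParTMPolyTime L 0 := by
  obtain ⟨M, p, -, h⟩ := h
  refine ⟨M.sim, 3 * p + 8, ?_⟩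
  simpa using M.sim_decidesInTime L _ h

theorem EParTMPolyTime.mono {A : Type} {L : Language A} {ε ε' : ℚ} (hε : ε ≤ ε')
    (h : EParTMPolyTime L ε) : EParTMPolyTime L ε' := by
  obtain ⟨M, p, h⟩ := h
  refine ⟨M, p, fun x => ?_⟩
  obtain ⟨t, ht, h1, h2, h3, h4⟩ := h x
  exact ⟨t, ht, h1, h2, fun hx => (by linarith : 1 - ε' ≤ 1 - ε).trans (h3 hx),
    fun hx => (by linarith : 1 - ε' ≤ 1 - ε).trans (h4 hx)⟩

theorem mainTheorem7 :
    CSAT ∈ BEParTMPTIME CNFSymbol ∧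
    EParTMPolyTime CSAT 0 ∧
    (∀ (A : Type) [Finite A] (L : Language A), L ∈ ClassNP A → EParTMPolyTime L 0) :=
  have h : EParTMPolyTime CSAT 0 := eParTMPolyTime_of_mem_classNP csat_mem_classNP
  ⟨h.mono (by norm_num), h, fun _ _ _ hL => eParTMPolyTime_of_mem_classNP hL⟩
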